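/- Let $d\ge 1$ be an integer and let $\psi:\mathbb N=\{1,2,\dots\}\to(0,\infty)$ be a non-increasing function. Put $$W(d,\psi)=\Big\{\mathbf x\in[0,1]^d:\ \max_{1\le i\le d}\Big|x_i-\frac{p_i}{q}\Big|<\psi(q)\ \text{ for infinitely many } (\mathbf p,q)\in\mathbb Z^d\times\mathbb N\Big\}$$ and $$\mathrm{Exact}(d,\psi)=W(d,\psi)\setminus\bigcup_{0<\epsilon<1}W(d,(1-\epsilon)\psi).$$ Suppose that $\sum_{q=1}^\infty q^{3d}\psi(q)^d<\infty$. Then for every real $s\in(0,d)$ the $s$-dimensional Hausdorff measure (with respect to the sup-norm metric) satisfies $$\mathcal H^s(\mathrm{Exact}(d,\psi))=\begin{cases}0&\text{if }\ \sum_{q=1}^\infty q^d\psi(q)^s<\infty,\\[2pt] \infty&\text{if }\ \sum_{q=1}^\infty q^d\psi(q)^s=\infty.\end{cases}$$ -/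

import Mathlib

/-- The set `W(d, ψ)` of simultaneously `ψ`-well approximable points of the unit cube: those
`x ∈ [0,1]^d` with `|x - p/q|_∞ < ψ q` for infinitely many pairs `(p, q) ∈ ℤ^d × ℕ`, `q ≥ 1`.
The norm on `Fin d → ℝ` is the maximum norm. -/
def wellApprox (d : ℕ) (ψ : ℕ → ℝ) : Set (Fin d → ℝ) :=
  {x | x ∈ Set.Icc (0 : Fin d → ℝ) 1 ∧
    {pq : (Fin d → ℤ) × ℕ |
      1 ≤ pq.2 ∧ ‖x - (fun i => (pq.1 i : ℝ) / (pq.2 : ℝ))‖ < ψ pq.2}.Infinite}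

/-- The set `Exact(d, ψ) = W(d, ψ) \ ⋃_{0 < ε < 1} W(d, (1 - ε) ψ)` of simultaneously
`ψ`-exactly approximable points of the unit cube. -/
def exactApprox (d : ℕ) (ψ : ℕ → ℝ) : Set (Fin d → ℝ) :=
  wellApprox d ψ \ ⋃ ε ∈ Set.Ioo (0 : ℝ) 1, wellApprox d (fun q => (1 - ε) * ψ q)

/-! Convergence is the Hausdorff–Cantelli argument: the balls of radius `ψ q` about rational vectors
of denominator at least `n` cover `wellApprox d ψ`, and about `q ^ d` of them matter for each `q`.

For divergence, suppose the measure is finite. Then there are covers by sets `U i` of diameter at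
most `ρ i`, with bounded `∑ ρ i ^ s` and all `ρ i` as small as desired. An exactly approximable
point outside every `U i` is built as the limit of nested balls. Each ball of radius `r` keeps its
hit mass, the sum of `ρ i ^ s` over the `U i` meeting it, below `c * r ^ s`. A set containing the
limit point would then have `ρ i ^ s` at most `c * r ^ s` for `r → 0`, which is impossible.

To descend, Dirichlet's theorem and a volume count give, at each scale `N`, about `(r / τ) ^ d`
rational vectors in the ball, with denominator comparable to `N ^ d`, mutually `3 τ`-separated for
`τ = N ^ (-(d + 1))`, and away from other rationals and from earlier scales
(`exists_children_level`, `exists_isFamily`). A small set meets at most one child of the scales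
coarser than itself and few of each finer scale. Since the series diverges, enough scales carry so
much total weight that some child is hit by little mass (`exists_tsum_hit_lt`,
`exists_child_hitMass_lt`).

The next ball lies in the shell between `(1 - ε) * ψ q` and `ψ q` around that child. With `ε → 0`
the limit is exactly approximable: all rationals with denominators between consecutive thresholds
are excluded (`IsChild.le_dist_ratVec`), and the new ball is again clean (`isClean_nextDen`). The
hypothesis on `q ^ (3 * d) * ψ q ^ d` enters only through `2 * q ^ 3 * ψ q ≤ 1` for large `q`. -/

open MeasureTheory Metric Set

/-! ### Rational vectors and their denominators -/

/-- The rational vector `p / q`. -/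
noncomputable def ratVec {d : ℕ} (p : Fin d → ℤ) (q : ℕ) : Fin d → ℝ :=
  fun i => (p i : ℝ) / (q : ℝ)

/-- The least common denominator of a rational vector (and `0` for all other vectors). -/
noncomputable def vecDen {d : ℕ} (a : Fin d → ℝ) : ℕ :=
  sInf {q : ℕ | 1 ≤ q ∧ ∃ p, a = ratVec p q}

lemma vecDen_spec {d : ℕ} {a : Fin d → ℝ} {q : ℕ} {p : Fin d → ℤ} (hq : 1 ≤ q)
    (h : a = ratVec p q) : 1 ≤ vecDen a ∧ ∃ p', a = ratVec p' (vecDen a) :=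
  Nat.sInf_mem (s := {q : ℕ | 1 ≤ q ∧ ∃ p, a = ratVec p q}) ⟨q, hq, p, h⟩

lemma vecDen_le {d : ℕ} {a : Fin d → ℝ} {q : ℕ} {p : Fin d → ℤ} (hq : 1 ≤ q)
    (h : a = ratVec p q) : vecDen a ≤ q :=
  Nat.sInf_le (s := {q : ℕ | 1 ≤ q ∧ ∃ p, a = ratVec p q}) ⟨hq, p, h⟩

/-- Distinct rational vectors with denominators `q` and `q'` are `1 / (q q')` apart. -/
lemma one_div_le_norm_ratVec_sub {d : ℕ} {p p' : Fin d → ℤ} {q q' : ℕ} (hq : 1 ≤ q) (hq' : 1 ≤ q')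
    (h : ratVec p q ≠ ratVec p' q') : 1 / ((q : ℝ) * q') ≤ ‖ratVec p q - ratVec p' q'‖ := by
  have hq0 : (0 : ℝ) < q := by exact_mod_cast hq
  have hq0' : (0 : ℝ) < q' := by exact_mod_cast hq'
  obtain ⟨i, hi⟩ := Function.ne_iff.mp h
  refine le_trans ?_ (norm_le_pi_norm _ i)
  simp only [ratVec, Pi.sub_apply, Real.norm_eq_abs] at hi ⊢
  have e : (p i : ℝ) / q - (p' i : ℝ) / q' = ((p i * q' - p' i * q : ℤ) : ℝ) / (q * q') := by
    push_cast; field_simp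
  rw [e, abs_div, abs_of_pos (mul_pos hq0 hq0')]
  gcongr
  have hne : p i * q' - p' i * q ≠ 0 := by
    intro h0
    apply hi
    rw [← sub_eq_zero, e, h0]; simp
  exact_mod_cast Int.one_le_abs hne

/-! ### Volume comparison and counting -/

lemma volume_ball_le {d : ℕ} (c : Fin d → ℝ) {ρ : ℝ} (hρ : 0 ≤ ρ) :
    volume (ball c ρ) ≤ ENNReal.ofReal ((2 * ρ) ^ d) := by
  have h := Real.volume_pi_closedBall c hρ
  rw [Fintype.card_fin] at h
  exact h ▸ measure_mono ball_subset_closedBall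

lemma pow_le_sum_of_ball_subset {d : ℕ} {ι : Type*} (T : Finset ι) (c : ι → Fin d → ℝ) (ρ : ι → ℝ)
    (hρ : ∀ i ∈ T, 0 ≤ ρ i) {z : Fin d → ℝ} {R : ℝ} (hR : 0 < R)
    (h : ∀ x ∈ ball z R, ∃ i ∈ T, x ∈ ball (c i) (ρ i)) : R ^ d ≤ ∑ i ∈ T, ρ i ^ d := by
  have h1 : volume (ball z R) ≤ ∑ i ∈ T, volume (ball (c i) (ρ i)) := by
    refine le_trans (measure_mono fun x hx => ?_) (measure_biUnion_finset_le T _)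
    simpa using h x hx
  rw [Real.volume_pi_ball z hR, Fintype.card_fin] at h1
  have h2 : ENNReal.ofReal ((2 * R) ^ d) ≤ ENNReal.ofReal (∑ i ∈ T, (2 * ρ i) ^ d) := by
    rw [ENNReal.ofReal_sum_of_nonneg fun i hi => pow_nonneg (by linarith [hρ i hi]) d]
    exact h1.trans (Finset.sum_le_sum fun i hi => volume_ball_le _ (hρ i hi))
  rw [ENNReal.ofReal_le_ofReal_iff
    (Finset.sum_nonneg fun i hi => pow_nonneg (by linarith [hρ i hi]) d)] at h2
  simp only [mul_pow, ← Finset.mul_sum] at h2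
  exact le_of_mul_le_mul_left h2 (by positivity)

/-- The volume bound for a cover by three families. They will be the rationals with forbidden
denominators, the points of earlier levels, and the net of new children, so the bound forces the net
to be large. -/
lemma pow_le_add_of_ball_subset {d : ℕ} {ι₁ ι₂ ι₃ : Type*} (A : Finset ι₁) (B : Finset ι₂)
    (C : Finset ι₃) (a : ι₁ → Fin d → ℝ) (b : ι₂ → Fin d → ℝ) (c : ι₃ → Fin d → ℝ)
    (u : ι₁ → ℝ) (v : ι₂ → ℝ) (w : ι₃ → ℝ)
    (hu : ∀ i ∈ A, 0 ≤ u i) (hv : ∀ i ∈ B, 0 ≤ v i) (hw : ∀ i ∈ C, 0 ≤ w i)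
    {z : Fin d → ℝ} {R : ℝ} (hR : 0 < R)
    (h : ∀ x ∈ ball z R, (∃ i ∈ A, dist x (a i) < u i) ∨ (∃ i ∈ B, dist x (b i) < v i) ∨
      ∃ i ∈ C, dist x (c i) < w i) :
    R ^ d ≤ ∑ i ∈ A, u i ^ d + (∑ i ∈ B, v i ^ d + ∑ i ∈ C, w i ^ d) := by
  have := pow_le_sum_of_ball_subset (A.disjSum (B.disjSum C)) (Sum.elim a (Sum.elim b c))
    (Sum.elim u (Sum.elim v w)) (by
      rintro (i | i | i) hi <;> simp at hi ⊢
      exacts [hu i hi, hv i hi, hw i hi]) hR (by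
      intro x hx
      rcases h x hx with ⟨i, hi, h⟩ | ⟨i, hi, h⟩ | ⟨i, hi, h⟩
      · exact ⟨Sum.inl i, by simpa using hi, by simpa using h⟩
      · exact ⟨Sum.inr (Sum.inl i), by simpa using hi, by simpa using h⟩
      · exact ⟨Sum.inr (Sum.inr i), by simpa using hi, by simpa using h⟩)
  simpa [Finset.sum_disjSum] using this

/-- A `σ`-separated subset of a ball of radius `R` has at most `(2 R / σ + 1) ^ d` points. -/
lemma card_le_of_separated {d : ℕ} (S : Finset (Fin d → ℝ)) {z : Fin d → ℝ} {R σ : ℝ}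
    (hR : 0 ≤ R) (hσ : 0 < σ) (hS : ∀ a ∈ S, dist a z ≤ R)
    (hsep : ∀ a ∈ S, ∀ b ∈ S, a ≠ b → σ ≤ dist a b) : (S.card : ℝ) ≤ (2 * R / σ + 1) ^ d := by
  have h1 : volume (⋃ a ∈ S, ball a (σ / 2)) = ∑ a ∈ S, volume (ball a (σ / 2)) := by
    refine measure_biUnion_finset (fun a ha b hb hab => ?_) fun a _ => measurableSet_ball
    exact ball_disjoint_ball (by linarith [hsep a ha b hb hab])
  have h2 : (⋃ a ∈ S, ball a (σ / 2)) ⊆ closedBall z (R + σ / 2) := by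
    intro x hx
    simp only [mem_iUnion, mem_ball, exists_prop] at hx
    obtain ⟨a, ha, hx⟩ := hx
    rw [mem_closedBall]
    linarith [dist_triangle x a z, hS a ha]
  have h3 := measure_mono (μ := volume) h2
  rw [h1, Real.volume_pi_closedBall z (by positivity), Fintype.card_fin] at h3
  simp only [Real.volume_pi_ball _ (half_pos hσ), Fintype.card_fin, Finset.sum_const,
    nsmul_eq_mul] at h3
  rw [← ENNReal.ofReal_natCast, ← ENNReal.ofReal_mul (by positivity),
    ENNReal.ofReal_le_ofReal_iff (by positivity)] at h3
  have e1 : 2 * (σ / 2) = σ := by ring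
  have e2 : 2 * (R + σ / 2) = (2 * R / σ + 1) * σ := by field_simp
  rw [e1, e2, mul_pow] at h3
  exact le_of_mul_le_mul_right h3 (by positivity)

lemma finite_ratVec {d : ℕ} (z : Fin d → ℝ) (r : ℝ) {q : ℕ} (hq : 1 ≤ q) :
    {p : Fin d → ℤ | dist (ratVec p q) z ≤ r}.Finite := by
  have hq0 : (0 : ℝ) < q := by exact_mod_cast hq
  refine (Set.finite_Icc (fun i => ⌊q * (z i - r)⌋) fun i => ⌈q * (z i + r)⌉).subset ?_
  intro p hp
  have key : ∀ i, |(p i : ℝ) / q - z i| ≤ r := fun i => by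
    have := (dist_le_pi_dist (ratVec p q) z i).trans hp
    simpa [ratVec, Real.dist_eq] using this
  refine ⟨fun i => ?_, fun i => ?_⟩
  · have h := (abs_le.mp (key i)).1
    have : (q : ℝ) * (z i - r) ≤ p i := by
      rw [← le_div_iff₀' hq0]; linarith
    exact_mod_cast (Int.floor_le _).trans this
  · have h := (abs_le.mp (key i)).2
    have : (p i : ℝ) ≤ q * (z i + r) := by
      rw [← div_le_iff₀' hq0]; linarith
    exact_mod_cast this.trans (Int.le_ceil _)

open Classical in
/-- The rational vectors with denominator `q` in the closed ball of radius `r` around `z`. -/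
noncomputable def ratPts {d : ℕ} (z : Fin d → ℝ) (r : ℝ) (q : ℕ) : Finset (Fin d → ℝ) :=
  if hq : 1 ≤ q then (finite_ratVec z r hq).toFinset.image (fun p => ratVec p q) else ∅

lemma mem_ratPts {d : ℕ} {z : Fin d → ℝ} {r : ℝ} {q : ℕ} {a : Fin d → ℝ} :
    a ∈ ratPts z r q ↔ 1 ≤ q ∧ dist a z ≤ r ∧ ∃ p, a = ratVec p q := by
  unfold ratPts
  split_ifs with hq
  · simp only [Finset.mem_image, Finite.mem_toFinset, Set.mem_ofPred_eq]
    constructor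
    · rintro ⟨p, hp, rfl⟩; exact ⟨hq, hp, p, rfl⟩
    · rintro ⟨-, hp, p, rfl⟩; exact ⟨p, hp, rfl⟩
  · simp [hq]

lemma card_ratPts_le {d : ℕ} (z : Fin d → ℝ) {r : ℝ} (hr : 0 ≤ r) (q : ℕ) :
    ((ratPts z r q).card : ℝ) ≤ (2 * r * q + 1) ^ d := by
  by_cases hq : 1 ≤ q
  · have hq0 : (0 : ℝ) < q := by exact_mod_cast hq
    have h := card_le_of_separated (ratPts z r q) (z := z) (R := r) (σ := 1 / (q : ℝ)) hr
      (by positivity) (fun a ha => (mem_ratPts.mp ha).2.1) (by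
        intro a ha b hb hab
        obtain ⟨p, rfl⟩ := (mem_ratPts.mp ha).2.2
        obtain ⟨p', rfl⟩ := (mem_ratPts.mp hb).2.2
        obtain ⟨i, hi⟩ := Function.ne_iff.mp hab
        refine le_trans ?_ (dist_le_pi_dist _ _ i)
        have e : (p i : ℝ) / q - (p' i : ℝ) / q = ((p i - p' i : ℤ) : ℝ) / q := by
          push_cast; ring
        simp only [ratVec, Real.dist_eq] at hi ⊢
        rw [e, abs_div, abs_of_pos hq0]
        gcongr
        have hne : p i - p' i ≠ 0 := by
          intro h0; apply hi; rw [sub_eq_zero.mp h0]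
        exact_mod_cast Int.one_le_abs hne)
    have e : 2 * r / (1 / (q : ℝ)) + 1 = 2 * r * q + 1 := by field_simp
    rwa [e] at h
  · have : q = 0 := by omega
    subst this
    simp [ratPts]

/-! ### Dirichlet's theorem -/

/-- Dirichlet's theorem on simultaneous approximation. -/
lemma exists_ratVec_dist_lt {d : ℕ} (x : Fin d → ℝ) {N : ℕ} (hN : 1 ≤ N) :
    ∃ (q : ℕ) (p : Fin d → ℤ), 1 ≤ q ∧ q ≤ N ^ d ∧ dist x (ratVec p q) < 1 / ((q : ℝ) * N) := by
  have hN0 : (0 : ℝ) < N := by exact_mod_cast hN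
  -- Pigeonhole: `f q` is the box of side `1 / N` containing the fractional parts of `q x`, and the
  -- `N ^ d + 1` multiples `0, …, N ^ d` share `N ^ d` boxes.
  let f : ℕ → Fin d → Fin N := fun q i =>
    ⟨⌊Int.fract (q * x i) * N⌋₊, by
      rw [Nat.floor_lt (by have := Int.fract_nonneg (q * x i); positivity)]
      have := Int.fract_lt_one (q * x i)
      nlinarith⟩
  obtain ⟨a, ha, b, hb, hab, hf⟩ := Finset.exists_ne_map_eq_of_card_lt_of_maps_to
    (s := Finset.range (N ^ d + 1)) (t := Finset.univ) (f := f) (by simp) (by simp)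
  wlog hlt : a < b generalizing a b
  · exact this b hb a ha hab.symm hf.symm (by omega)
  simp only [Finset.mem_range] at ha hb
  refine ⟨b - a, fun i => ⌊(b : ℝ) * x i⌋ - ⌊(a : ℝ) * x i⌋, by omega, by omega, ?_⟩
  have hba : (0 : ℝ) < (b - a : ℕ) := by exact_mod_cast Nat.sub_pos_of_lt hlt
  rw [dist_pi_lt_iff (by positivity)]
  intro i
  have hi := congrArg Fin.val (congrFun hf i)
  simp only [f] at hi
  have h1 := Nat.floor_le (a := Int.fract ((a : ℝ) * x i) * N)
    (mul_nonneg (Int.fract_nonneg _) hN0.le)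
  have h2 := Nat.lt_floor_add_one (Int.fract ((a : ℝ) * x i) * N)
  have h3 := Nat.floor_le (a := Int.fract ((b : ℝ) * x i) * N)
    (mul_nonneg (Int.fract_nonneg _) hN0.le)
  have h4 := Nat.lt_floor_add_one (Int.fract ((b : ℝ) * x i) * N)
  rw [hi] at h1 h2
  have h5 : |(Int.fract ((b : ℝ) * x i) - Int.fract ((a : ℝ) * x i)) * N| < 1 := by
    rw [abs_lt]; constructor <;> nlinarith
  have e : x i - (((⌊(b : ℝ) * x i⌋ - ⌊(a : ℝ) * x i⌋ : ℤ)) : ℝ) / ((b - a : ℕ) : ℝ)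
      = (Int.fract ((b : ℝ) * x i) - Int.fract ((a : ℝ) * x i)) * N / (((b - a : ℕ) : ℝ) * N) := by
    simp only [Int.fract]
    have hc : ((b - a : ℕ) : ℝ) = b - a := by push_cast [hlt.le]; ring
    rw [hc] at hba ⊢
    have := hba.ne'
    push_cast
    field_simp
    ring
  simp only [ratVec, Real.dist_eq]
  rw [e, abs_div, abs_of_pos (mul_pos hba hN0)]
  gcongr

/-! ### Children on a single level -/

/-- The proportion of a ball that each kind of forbidden region may occupy. -/
noncomputable def badRatio (d : ℕ) : ℝ := 1 / (8 * 2 ^ d)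

/-- Denominators below `denRatio d * Q` are ignored at the level of denominators up to `Q`. -/
noncomputable def denRatio (d : ℕ) : ℝ := badRatio d / 6 ^ d

/-- The density of the selected rational vectors on each level. -/
noncomputable def density (d : ℕ) : ℝ := (denRatio d / 8) ^ d / 2

lemma badRatio_pos (d : ℕ) : 0 < badRatio d := by unfold badRatio; positivity

lemma denRatio_pos (d : ℕ) : 0 < denRatio d := by
  unfold denRatio; have := badRatio_pos d; positivity

lemma density_pos (d : ℕ) : 0 < density d := by
  unfold density; have := denRatio_pos d; positivity

lemma badRatio_le_one (d : ℕ) : badRatio d ≤ 1 := by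
  unfold badRatio
  rw [div_le_one (by positivity)]
  linarith [one_le_pow₀ (M₀ := ℝ) one_le_two (n := d)]

lemma denRatio_le_one (d : ℕ) : denRatio d ≤ 1 := by
  unfold denRatio
  exact div_le_one_of_le₀ ((badRatio_le_one d).trans (one_le_pow₀ (by norm_num))) (by positivity)

/-- The balls around rational vectors of denominator at least `P` take up only a small part of a
ball of radius `r`. -/
def IsClean (d : ℕ) (ψ : ℕ → ℝ) (r : ℝ) (P : ℕ) : Prop :=
  ∀ n, ∑ q ∈ Finset.Ico P n, (2 * r * q + 1) ^ d * (4 * ψ q) ^ d ≤ badRatio d * r ^ d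

/-- A single term of the sum in `IsClean` already gives `(4 * ψ q) ^ d ≤ (r / 2) ^ d`. This keeps a
rational within `2 * ψ q` of a point of the ball of radius `3 * r / 4` inside the ball of radius
`r`. -/
lemma IsClean.eight_mul_le {d : ℕ} (hd : d ≠ 0) {ψ : ℕ → ℝ} (hψ : ∀ q, 1 ≤ q → 0 < ψ q) {r : ℝ}
    {P : ℕ} (h : IsClean d ψ r P) (hr : 0 < r) (hP : 1 ≤ P) {q : ℕ} (hq : P ≤ q) :
    8 * ψ q ≤ r := by
  have hψq := hψ q (hP.trans hq)
  have h1 : (2 * r * q + 1) ^ d * (4 * ψ q) ^ d ≤ badRatio d * r ^ d := by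
    refine le_trans ?_ (h (q + 1))
    refine Finset.single_le_sum (f := fun q : ℕ => (2 * r * q + 1) ^ d * (4 * ψ q) ^ d)
      (fun i hi => ?_) (Finset.mem_Ico.mpr ⟨hq, by omega⟩)
    have := hψ i (hP.trans (Finset.mem_Ico.mp hi).1)
    positivity
  have h2 : (4 * ψ q) ^ d ≤ (2 * r * q + 1) ^ d * (4 * ψ q) ^ d := by
    refine le_mul_of_one_le_left (by positivity) (one_le_pow₀ ?_)
    have : 0 ≤ 2 * r * q := by positivity
    linarith
  have h3 : badRatio d * r ^ d ≤ (r / 2) ^ d := by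
    rw [div_pow, div_eq_mul_inv, mul_comm]
    gcongr
    unfold badRatio
    rw [one_div]
    gcongr
    linarith [pow_pos (two_pos (α := ℝ)) d]
  have h4 := le_of_pow_le_pow_left₀ hd (by positivity) (h2.trans (h1.trans h3))
  linarith

/-- For `q ≥ 1 / r` a term is at most `(6 * r) ^ d / N ^ d`, and there are at most `denRatio d * N ^
d` of them: `denRatio` is chosen so that they total `badRatio d * r ^ d`. The fewer than `⌈1 / r⌉₊`
other terms are at most `6 ^ d / N ^ d` and are absorbed by `hbig`. -/
lemma sum_small_denominators_le {d : ℕ} {r : ℝ} (hr : 0 < r) (hr1 : r ≤ 1) {N : ℕ} (hN : 1 ≤ N)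
    (hbig : ⌈1 / r⌉₊ * 6 ^ d ≤ badRatio d * r ^ d * (N : ℝ) ^ d) :
    ∑ q ∈ Finset.Ico 1 ⌈denRatio d * (N : ℝ) ^ d⌉₊,
      (2 * r * q + 1) ^ d * (2 * (1 / ((q : ℝ) * N))) ^ d ≤ 2 * badRatio d * r ^ d := by
  have hN0 : (0 : ℝ) < N := by exact_mod_cast hN
  set H := ⌈denRatio d * (N : ℝ) ^ d⌉₊
  set R := ⌈1 / r⌉₊
  have hδ := denRatio_pos d
  have hterm : ∀ q ∈ Finset.Ico 1 H, (2 * r * q + 1) ^ d * (2 * (1 / ((q : ℝ) * N))) ^ d ≤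
      ((6 * r) ^ d + if q < R then 6 ^ d else 0) / (N : ℝ) ^ d := by
    intro q hq
    have hq0 : (0 : ℝ) < q := by exact_mod_cast (Finset.mem_Ico.mp hq).1
    have hq1 : (1 : ℝ) ≤ q := by exact_mod_cast (Finset.mem_Ico.mp hq).1
    have e : (2 * r * q + 1) ^ d * (2 * (1 / ((q : ℝ) * N))) ^ d
        = (2 * (2 * r + 1 / q)) ^ d / (N : ℝ) ^ d := by
      rw [← mul_pow, ← div_pow]; congr 1; field_simp
    rw [e]
    gcongr
    split_ifs with hqR
    · refine le_add_of_nonneg_of_le (by positivity) ?_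
      gcongr
      have : 1 / (q : ℝ) ≤ 1 := by rw [div_le_one hq0]; exact hq1
      linarith
    · rw [add_zero]
      refine pow_le_pow_left₀ (by positivity) ?_ d
      have : 1 / r ≤ q := (Nat.le_ceil _).trans (by exact_mod_cast not_lt.mp hqR)
      have : 1 / (q : ℝ) ≤ r := by
        rw [div_le_iff₀ hq0]; rw [div_le_iff₀ hr] at this; linarith
      linarith
  refine (Finset.sum_le_sum hterm).trans ?_
  rw [← Finset.sum_div, div_le_iff₀ (by positivity), Finset.sum_add_distrib, Finset.sum_const,
    nsmul_eq_mul, Nat.card_Ico]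
  have h1 : ((H - 1 : ℕ) : ℝ) ≤ denRatio d * (N : ℝ) ^ d := by
    have := Nat.ceil_lt_add_one (a := denRatio d * (N : ℝ) ^ d) (by positivity)
    have hH : 1 ≤ H := Nat.ceil_pos.mpr (by positivity)
    push_cast [hH]
    linarith
  have h2 : ∑ q ∈ Finset.Ico 1 H, (if q < R then (6 : ℝ) ^ d else 0) ≤ R * 6 ^ d := by
    rw [← Finset.sum_filter, Finset.sum_const, nsmul_eq_mul]
    gcongr
    calc _ ≤ (Finset.range R).card := Finset.card_le_card fun q hq => by
            simpa using (Finset.mem_filter.mp hq).2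
      _ = R := Finset.card_range R
  have h3 : ((H - 1 : ℕ) : ℝ) * (6 * r) ^ d ≤ badRatio d * r ^ d * (N : ℝ) ^ d := by
    calc _ ≤ denRatio d * (N : ℝ) ^ d * (6 * r) ^ d := by gcongr
      _ = badRatio d * r ^ d * (N : ℝ) ^ d := by
        unfold denRatio; rw [mul_pow]; field_simp
  linarith

/-- The scale of the level of denominators up to `N ^ d`. -/
noncomputable def spacing (d N : ℕ) : ℝ := 1 / (N : ℝ) ^ (d + 1)

/-- `a` is a rational vector in the ball around `z` of radius `r` whose denominator is comparable
to `N ^ d` and which is far from the rational vectors of smaller denominator at least `P`. -/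
structure IsChild {d : ℕ} (ψ : ℕ → ℝ) (z : Fin d → ℝ) (r : ℝ) (P N : ℕ) (a : Fin d → ℝ) :
    Prop where
  one_le : 1 ≤ vecDen a
  eq_ratVec : ∃ p, a = ratVec p (vecDen a)
  le_den : denRatio d * (N : ℝ) ^ d ≤ vecDen a
  den_le : vecDen a ≤ N ^ d
  dist_le : dist a z ≤ 3 * r / 4
  far : ∀ (q : ℕ) (p : Fin d → ℤ), P ≤ q → (q : ℝ) < denRatio d * (N : ℝ) ^ d →
    2 * ψ q ≤ dist a (ratVec p q)

/-- Every finite candidate set has a maximal `σ`-separated subset. -/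
lemma exists_separated_net {X : Type*} [PseudoMetricSpace X] (A : Finset X) {σ : ℝ} (hσ : 0 < σ) :
    ∃ S ⊆ A, (∀ a ∈ S, ∀ b ∈ S, a ≠ b → σ ≤ dist a b) ∧ ∀ x ∈ A, ∃ a ∈ S, dist x a < σ := by
  classical
  obtain ⟨S, hS⟩ := (A.powerset.filter
    fun S => ∀ a ∈ S, ∀ b ∈ S, a ≠ b → σ ≤ dist a b).exists_maximal ⟨∅, by simp⟩
  have hmem := hS.prop
  simp only [Finset.mem_filter, Finset.mem_powerset] at hmem
  refine ⟨S, hmem.1, hmem.2, fun x hx => ?_⟩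
  by_contra! hcon
  have hxS : x ∉ S := fun h => by
    have := hcon x h
    rw [dist_self] at this
    linarith
  have hins : insert x S ∈ A.powerset.filter
      fun S => ∀ a ∈ S, ∀ b ∈ S, a ≠ b → σ ≤ dist a b := by
    simp only [Finset.mem_filter, Finset.mem_powerset]
    refine ⟨Finset.insert_subset hx hmem.1, fun a ha b hb hab => ?_⟩
    rcases Finset.mem_insert.mp ha with ha | ha <;> rcases Finset.mem_insert.mp hb with hb | hb
    · exact absurd (ha.trans hb.symm) hab
    · exact ha ▸ hcon b hb
    · rw [dist_comm]; exact hb ▸ hcon a ha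
    · exact hmem.2 a ha b hb hab
  exact hxS (hS.2 hins (Finset.subset_insert x S) (Finset.mem_insert_self x S))

/-- Since `(x + y) ^ d ≤ (2 * x) ^ d + (2 * y) ^ d`, the radii split into a `ψ`-part, controlled by
cleanness, and a Dirichlet part, controlled by the smallness of the denominators. -/
lemma sum_forbidden_le {d : ℕ} {ψ : ℕ → ℝ} (hψ : ∀ q, 1 ≤ q → 0 < ψ q)
    {r : ℝ} {P : ℕ} (hr : 0 < r) (hr1 : r ≤ 1) (hP : 1 ≤ P) (hclean : IsClean d ψ r P)
    {N : ℕ} (hN : 1 ≤ N) (hbig : ⌈1 / r⌉₊ * 6 ^ d ≤ badRatio d * r ^ d * (N : ℝ) ^ d) :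
    ∑ q ∈ Finset.Ico 1 ⌈denRatio d * (N : ℝ) ^ d⌉₊,
      (2 * r * q + 1) ^ d * ((if P ≤ q then 2 * ψ q else 0) + 1 / ((q : ℝ) * N)) ^ d
        ≤ 3 * badRatio d * r ^ d := by
  set H := ⌈denRatio d * (N : ℝ) ^ d⌉₊
  have hterm : ∀ q ∈ Finset.Ico 1 H,
      (2 * r * q + 1) ^ d * ((if P ≤ q then 2 * ψ q else 0) + 1 / ((q : ℝ) * N)) ^ d ≤
      (if P ≤ q then (2 * r * q + 1) ^ d * (4 * ψ q) ^ d else 0) +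
        (2 * r * q + 1) ^ d * (2 * (1 / ((q : ℝ) * N))) ^ d := by
    intro q hq
    have hψq := hψ q (Finset.mem_Ico.mp hq).1
    have hpow : ∀ x y : ℝ, 0 ≤ x → 0 ≤ y → (x + y) ^ d ≤ (2 * x) ^ d + (2 * y) ^ d := by
      intro x y hx hy
      rcases le_total x y with h | h
      · exact le_add_of_nonneg_of_le (by positivity) (by gcongr; linarith)
      · exact le_add_of_le_of_nonneg (by gcongr; linarith) (by positivity)
    split_ifs with h
    · rw [← mul_add]
      gcongr
      refine (hpow _ _ (by positivity) (by positivity)).trans_eq ?_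
      ring
    · rw [zero_add, zero_add]
      gcongr
      have : 0 ≤ 1 / ((q : ℝ) * N) := by positivity
      linarith
  refine (Finset.sum_le_sum hterm).trans ?_
  rw [Finset.sum_add_distrib]
  have h1 := sum_small_denominators_le hr hr1 hN hbig
  have h2 : ∑ q ∈ Finset.Ico 1 H, (if P ≤ q then (2 * r * q + 1) ^ d * (4 * ψ q) ^ d else 0)
      ≤ badRatio d * r ^ d := by
    rw [← Finset.sum_filter]
    refine le_trans (Finset.sum_le_sum_of_subset_of_nonneg (fun q hq => ?_) fun q hq _ => ?_)
      (hclean H)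
    · simp only [Finset.mem_filter, Finset.mem_Ico] at hq ⊢
      exact ⟨hq.2, hq.1.2⟩
    · have := hψ q (hP.trans (Finset.mem_Ico.mp hq).1)
      positivity
  linarith

/-- On each level there are many well separated children keeping away from a given finite union of
small balls. -/
lemma exists_children_level {d : ℕ} (hd : d ≠ 0) {ψ : ℕ → ℝ} (hψ : ∀ q, 1 ≤ q → 0 < ψ q)
    (z : Fin d → ℝ) {r : ℝ} {P : ℕ} (hr : 0 < r) (hr1 : r ≤ 1) (hP : 1 ≤ P)
    (hclean : IsClean d ψ r P)
    {N : ℕ} (hN : 1 ≤ N) (hbig : ⌈1 / r⌉₊ * 6 ^ d ≤ badRatio d * r ^ d * (N : ℝ) ^ d)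
    (hNr : 1 / (N : ℝ) ≤ r / 2) (hτr : spacing d N / denRatio d ≤ r / 4)
    (T : Finset (Fin d → ℝ)) (g : (Fin d → ℝ) → ℝ) (hg : ∀ t ∈ T, 0 ≤ g t)
    (hT : ∑ t ∈ T, (g t + 3 * spacing d N / denRatio d) ^ d ≤ badRatio d * r ^ d) :
    ∃ S : Finset (Fin d → ℝ),
      (∀ a ∈ S, IsChild ψ z r P N a ∧ ∀ t ∈ T, g t + 2 * spacing d N ≤ dist a t) ∧
      (∀ a ∈ S, ∀ b ∈ S, a ≠ b → 3 * spacing d N ≤ dist a b) ∧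
      density d * r ^ d ≤ S.card * spacing d N ^ d := by
  classical
  have hN0 : (0 : ℝ) < N := by exact_mod_cast hN
  have hδ := denRatio_pos d
  have hδ1 := denRatio_le_one d
  set τ := spacing d N with hτdef
  have hτ : 0 < τ := by rw [hτdef]; unfold spacing; positivity
  set H := ⌈denRatio d * (N : ℝ) ^ d⌉₊ with hH
  set A : Finset (Fin d → ℝ) := ((Finset.range (N ^ d + 1)).biUnion (ratPts z r)).filter
    fun a => IsChild ψ z r P N a ∧ ∀ t ∈ T, g t + 2 * τ ≤ dist a t with hA
  obtain ⟨S, hSA, hsep, hnet⟩ := exists_separated_net A (σ := 3 * τ) (by positivity)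
  refine ⟨S, fun a ha => (Finset.mem_filter.mp (hSA ha)).2, hsep, ?_⟩
  -- The Dirichlet vector `a` of a point `x` has too small a denominator, or is near a forbidden
  -- rational, or is near `T`, or is a candidate and so within `3 * τ` of the net. Outside the first
  -- case `x` is within `τ / denRatio d` of `a`; as `denRatio d ≤ 1`, this explains the factors `3 =
  -- 2 + 1` and `4 = 3 + 1`. The radius `r / 2` leaves room for `a` inside the ball around `z`.
  have hcover := pow_le_add_of_ball_subset
    ((Finset.Ico 1 H).sigma fun q => ratPts z r q) T S
    (fun i => i.2) id id
    (fun i => (if P ≤ i.1 then 2 * ψ i.1 else 0) + 1 / ((i.1 : ℝ) * N))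
    (fun t => g t + 3 * τ / denRatio d) (fun _ => 4 * τ / denRatio d)
    (by
      rintro ⟨q, b⟩ hi
      have := hψ q (Finset.mem_Ico.mp (Finset.mem_sigma.mp hi).1).1
      dsimp only
      split_ifs <;> positivity)
    (fun t ht => by have := hg t ht; positivity) (fun _ _ => by positivity)
    (z := z) (R := r / 2) (by positivity) (by
      intro x hx
      rw [mem_ball] at hx
      obtain ⟨q, p, hq1, hqQ, hxa⟩ := exists_ratVec_dist_lt x hN
      obtain ⟨a, hadef⟩ : ∃ a, a = ratVec p q := ⟨_, rfl⟩
      rw [← hadef] at hxa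
      obtain ⟨hden1, pa, hpa⟩ := vecDen_spec hq1 hadef
      have hdenq := vecDen_le hq1 hadef
      have hden0 : (0 : ℝ) < vecDen a := by exact_mod_cast hden1
      have hxa' : dist x a < 1 / ((vecDen a : ℝ) * N) := by
        refine hxa.trans_le ?_
        gcongr
      have haz : dist a z ≤ dist x a + dist x z := dist_triangle_left a z x
      by_cases hlow : (vecDen a : ℝ) < denRatio d * (N : ℝ) ^ d
      · left
        refine ⟨⟨vecDen a, a⟩, ?_, ?_⟩
        · simp only [Finset.mem_sigma, Finset.mem_Ico]
          refine ⟨⟨hden1, Nat.lt_ceil.mpr hlow⟩, mem_ratPts.mpr ⟨hden1, ?_, pa, hpa⟩⟩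
          have : 1 / ((vecDen a : ℝ) * N) ≤ 1 / (N : ℝ) := by
            gcongr
            exact le_mul_of_one_le_left hN0.le (by exact_mod_cast hden1)
          linarith
        · have := hψ _ hden1
          dsimp only
          refine lt_add_of_nonneg_of_lt ?_ hxa'
          split_ifs <;> positivity
      rw [not_lt] at hlow
      have hxτ : dist x a < τ / denRatio d := by
        refine hxa'.trans_le ?_
        rw [hτdef, spacing, div_div]
        refine one_div_le_one_div_of_le (by positivity) ?_
        calc (N : ℝ) ^ (d + 1) * denRatio d = denRatio d * (N : ℝ) ^ d * N := by ring
          _ ≤ vecDen a * N := by gcongr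
      have haz' : dist a z ≤ 3 * r / 4 := by linarith
      by_cases hfar : ∀ (q : ℕ) (p : Fin d → ℤ), P ≤ q → (q : ℝ) < denRatio d * (N : ℝ) ^ d →
        2 * ψ q ≤ dist a (ratVec p q)
      · have hchild : IsChild ψ z r P N a :=
          ⟨hden1, ⟨pa, hpa⟩, hlow, hdenq.trans hqQ, haz', hfar⟩
        right
        by_cases hfarT : ∀ t ∈ T, g t + 2 * τ ≤ dist a t
        · right
          have haA : a ∈ A := by
            refine Finset.mem_filter.mpr ⟨?_, hchild, hfarT⟩
            simp only [Finset.mem_biUnion, Finset.mem_range]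
            exact ⟨vecDen a, by omega, mem_ratPts.mpr ⟨hden1, by linarith, pa, hpa⟩⟩
          obtain ⟨b, hb, hab⟩ := hnet a haA
          refine ⟨b, hb, ?_⟩
          have h3 : 3 * τ ≤ 3 * τ / denRatio d := le_div_self (by positivity) hδ hδ1
          have := dist_triangle x a b
          have e : 4 * τ / denRatio d = 3 * τ / denRatio d + τ / denRatio d := by ring
          rw [e, id]
          linarith
        · left
          push Not at hfarT
          obtain ⟨t, ht, hat⟩ := hfarT
          refine ⟨t, ht, ?_⟩
          have h3 : 2 * τ ≤ 2 * τ / denRatio d := le_div_self (by positivity) hδ hδ1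
          have := dist_triangle x a t
          have e : 3 * τ / denRatio d = 2 * τ / denRatio d + τ / denRatio d := by ring
          rw [e, id]
          linarith
      · left
        push Not at hfar
        obtain ⟨q', p', hPq', hq'lt, hab⟩ := hfar
        have hq'1 : 1 ≤ q' := hP.trans hPq'
        have hq'0 : (0 : ℝ) < q' := by exact_mod_cast hq'1
        have h8 := hclean.eight_mul_le hd hψ hr hP hPq'
        refine ⟨⟨q', ratVec p' q'⟩, ?_, ?_⟩
        · simp only [Finset.mem_sigma, Finset.mem_Ico]
          refine ⟨⟨hq'1, Nat.lt_ceil.mpr hq'lt⟩, mem_ratPts.mpr ⟨hq'1, ?_, p', rfl⟩⟩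
          have := dist_triangle_left (ratVec p' q') z a
          linarith
        · dsimp only
          rw [if_pos hPq']
          -- The forbidden `q'` is smaller than the denominator of `a`, so the Dirichlet error of
          -- `a` fits into the enlargement `1 / (q' * N)`.
          have h1 : 1 / ((vecDen a : ℝ) * N) ≤ 1 / ((q' : ℝ) * N) := by
            have : (q' : ℝ) ≤ vecDen a := hq'lt.le.trans hlow
            gcongr
          have := dist_triangle x a (ratVec p' q')
          linarith)
  rw [Finset.sum_sigma] at hcover
  have h1 : ∑ q ∈ Finset.Ico 1 H, ∑ _b ∈ ratPts z r q,
      ((if P ≤ q then 2 * ψ q else 0) + 1 / ((q : ℝ) * N)) ^ d ≤ 3 * badRatio d * r ^ d := by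
    refine le_trans (Finset.sum_le_sum fun q hq => ?_)
      (sum_forbidden_le hψ hr hr1 hP hclean hN hbig)
    rw [Finset.sum_const, nsmul_eq_mul]
    have := hψ q (Finset.mem_Ico.mp hq).1
    have h0 : 0 ≤ (if P ≤ q then 2 * ψ q else 0) := by split_ifs <;> positivity
    have h0' : 0 ≤ 1 / ((q : ℝ) * N) := by positivity
    exact mul_le_mul_of_nonneg_right (card_ratPts_le z hr.le q) (by positivity)
  rw [Finset.sum_const, nsmul_eq_mul] at hcover
  -- Forbidden balls use `3 + 1` shares of `badRatio d * r ^ d`, while the ball of radius `r / 2` is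
  -- worth `8`: the net accounts for the other half.
  have h2 : (r / 2) ^ d ≤ 4 * badRatio d * r ^ d + S.card * (4 * τ / denRatio d) ^ d := by
    linarith
  have e1 : (r / 2) ^ d = 8 * badRatio d * r ^ d := by
    unfold badRatio; rw [div_pow]; field_simp
  have e2 : 4 * badRatio d * r ^ d = (r / 2) ^ d / 2 := by rw [e1]; ring
  have h3 : (r / 2) ^ d / 2 ≤ S.card * (4 * τ / denRatio d) ^ d := by linarith
  have e3 : density d * r ^ d = (r / 2) ^ d / 2 * (denRatio d / 4) ^ d := by
    unfold density
    have : (denRatio d / 8) ^ d * r ^ d = (r / 2) ^ d * (denRatio d / 4) ^ d := by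
      rw [← mul_pow, ← mul_pow]; congr 1; ring
    linarith
  rw [e3]
  calc _ ≤ S.card * (4 * τ / denRatio d) ^ d * (denRatio d / 4) ^ d := by gcongr
    _ = S.card * τ ^ d := by
      rw [mul_assoc, ← mul_pow]; congr 2; field_simp

/-! ### Scales fine enough for a given ball -/

lemma spacing_pos {d N : ℕ} (hN : 1 ≤ N) : 0 < spacing d N := by
  have : (0 : ℝ) < N := by exact_mod_cast hN
  unfold spacing; positivity

lemma spacing_le_inv {d N : ℕ} (hN : 1 ≤ N) : spacing d N ≤ 1 / (N : ℝ) := by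
  have h1 : (1 : ℝ) ≤ N := by exact_mod_cast hN
  have h0 : (0 : ℝ) < N := by linarith
  unfold spacing
  refine one_div_le_one_div_of_le h0 ?_
  exact le_self_pow₀ h1 (by omega)

/-- The level of denominators up to `N ^ d` is fine enough for balls of radius `r` and for
denominators at least `B`. -/
structure IsFine (d : ℕ) (r B : ℝ) (N : ℕ) : Prop where
  one_le : 1 ≤ N
  big : ⌈1 / r⌉₊ * 6 ^ d ≤ badRatio d * r ^ d * (N : ℝ) ^ d
  inv_le : 1 / (N : ℝ) ≤ r / 2
  spacing_le : spacing d N / denRatio d ≤ r / 4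
  le_den : B ≤ denRatio d * (N : ℝ) ^ d
  ratio_le : 2 / (denRatio d ^ 3 * badRatio d) ≤ N

lemma exists_isFine {d : ℕ} (hd : d ≠ 0) {r : ℝ} (hr : 0 < r) (B : ℝ) :
    ∃ N₀ : ℕ, ∀ N ≥ N₀, IsFine d r B N := by
  have hδ := denRatio_pos d
  have hκ := badRatio_pos d
  obtain ⟨N₀, hN₀⟩ := exists_nat_ge (1 + ⌈1 / r⌉₊ * 6 ^ d / (badRatio d * r ^ d) + 2 / r +
    4 / (denRatio d * r) + |B| / denRatio d + 2 / (denRatio d ^ 3 * badRatio d))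
  refine ⟨N₀, fun N hN => ?_⟩
  have hN' : (N₀ : ℝ) ≤ N := by exact_mod_cast hN
  have p1 : 0 ≤ ⌈1 / r⌉₊ * 6 ^ d / (badRatio d * r ^ d) := by positivity
  have p2 : 0 < 2 / r := by positivity
  have p3 : 0 < 4 / (denRatio d * r) := by positivity
  have p4 : 0 ≤ |B| / denRatio d := by positivity
  have p5 : 0 < 2 / (denRatio d ^ 3 * badRatio d) := by positivity
  have h1 : (1 : ℝ) ≤ N := by linarith
  have h1' : 1 ≤ N := by exact_mod_cast h1
  have h0 : (0 : ℝ) < N := by linarith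
  have hpow : (N : ℝ) ≤ (N : ℝ) ^ d := le_self_pow₀ h1 hd
  refine ⟨h1', ?_, ?_, ?_, ?_, by linarith⟩
  · have : ⌈1 / r⌉₊ * 6 ^ d / (badRatio d * r ^ d) ≤ (N : ℝ) ^ d := by linarith
    rwa [div_le_iff₀' (by positivity)] at this
  · have : 2 / r ≤ N := by linarith
    rw [div_le_iff₀ hr] at this
    rw [div_le_iff₀ h0]
    linarith
  · refine (div_le_div_of_nonneg_right (spacing_le_inv h1') hδ.le).trans ?_
    have : 4 / (denRatio d * r) ≤ N := by linarith
    rw [div_le_iff₀ (by positivity)] at this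
    rw [div_le_iff₀ hδ, div_le_iff₀ h0]
    linarith
  · have : |B| / denRatio d ≤ (N : ℝ) ^ d := by linarith
    rw [div_le_iff₀' hδ] at this
    exact (le_abs_self B).trans this

lemma IsFine.spacing_le_self {d : ℕ} {r B : ℝ} {N : ℕ} (h : IsFine d r B N) :
    spacing d N ≤ r / 4 :=
  (le_div_self (spacing_pos h.one_le).le (denRatio_pos d) (denRatio_le_one d)).trans h.spacing_le

/-- The balls attached to children are much smaller than the spacing. -/
lemma IsChild.psi_le {d : ℕ} (hd : d ≠ 0) {ψ : ℕ → ℝ} {B : ℝ}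
    (hψB : ∀ q : ℕ, B ≤ q → 2 * (q : ℝ) ^ 3 * ψ q ≤ 1) {z : Fin d → ℝ} {r : ℝ} {P N : ℕ}
    {a : Fin d → ℝ} (h : IsChild ψ z r P N a) (hN : IsFine d r B N) :
    ψ (vecDen a) ≤ spacing d N * (1 / (2 * denRatio d ^ 3 * N)) := by
  have hδ := denRatio_pos d
  have h1 : (1 : ℝ) ≤ N := by exact_mod_cast hN.one_le
  have h0 : (0 : ℝ) < N := by linarith
  have hden0 : (0 : ℝ) < vecDen a := by exact_mod_cast h.one_le
  have h2 := hψB (vecDen a) (hN.le_den.trans h.le_den)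
  have h3 : ψ (vecDen a) ≤ 1 / (2 * (vecDen a : ℝ) ^ 3) := by
    rw [le_div_iff₀ (by positivity)]; linarith
  refine h3.trans ?_
  rw [spacing, div_mul_div_comm, one_mul]
  refine one_div_le_one_div_of_le (by positivity) ?_
  have h4 : (denRatio d * (N : ℝ) ^ d) ^ 3 ≤ (vecDen a : ℝ) ^ 3 := by
    have := h.le_den; gcongr
  -- The exponent `3` in `hψB` is what gives `d + 2 ≤ d * 3` for every `d ≥ 1`, with equality at `d
  -- = 1`.
  have h5 : (N : ℝ) ^ (d + 2) ≤ (N : ℝ) ^ (d * 3) := pow_le_pow_right₀ h1 (by omega)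
  calc (N : ℝ) ^ (d + 1) * (2 * denRatio d ^ 3 * N) = 2 * (denRatio d ^ 3 * (N : ℝ) ^ (d + 2)) := by
        ring
    _ ≤ 2 * (denRatio d ^ 3 * (N : ℝ) ^ (d * 3)) := by gcongr
    _ = 2 * (denRatio d * (N : ℝ) ^ d) ^ 3 := by rw [mul_pow, ← pow_mul]
    _ ≤ _ := by linarith

lemma IsFine.ratio_small {d : ℕ} {r B : ℝ} {N : ℕ} (h : IsFine d r B N) :
    1 / (2 * denRatio d ^ 3 * N) ≤ badRatio d / 4 := by
  have hδ := denRatio_pos d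
  have hκ := badRatio_pos d
  have h0 : (0 : ℝ) < N := by exact_mod_cast h.one_le
  have h1 := h.ratio_le
  rw [div_le_iff₀ (by positivity)] at h1
  rw [div_le_iff₀ (by positivity)]
  linarith

lemma IsChild.psi_le_spacing {d : ℕ} (hd : d ≠ 0) {ψ : ℕ → ℝ} {B : ℝ}
    (hψB : ∀ q : ℕ, B ≤ q → 2 * (q : ℝ) ^ 3 * ψ q ≤ 1) {z : Fin d → ℝ} {r : ℝ} {P N : ℕ}
    {a : Fin d → ℝ} (h : IsChild ψ z r P N a) (hN : IsFine d r B N) :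
    ψ (vecDen a) ≤ spacing d N / 4 := by
  have h1 := h.psi_le hd hψB hN
  have h2 := hN.ratio_small
  have h3 := badRatio_le_one d
  have h4 := spacing_pos (d := d) hN.one_le
  nlinarith

/-! ### Families of children over many levels -/

/-- The ratio between consecutive scales. -/
noncomputable def levelBase (d : ℕ) : ℕ := ⌈12 / (denRatio d * badRatio d)⌉₊ + 2

lemma two_le_levelBase (d : ℕ) : 2 ≤ levelBase d := by unfold levelBase; omega

lemma le_levelBase (d : ℕ) : 12 / (denRatio d * badRatio d) ≤ levelBase d := by
  unfold levelBase
  push_cast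
  linarith [Nat.le_ceil (12 / (denRatio d * badRatio d))]

lemma sum_geom_le {M : ℝ} (hM : 2 ≤ M) (k₀ k : ℕ) :
    ∑ j ∈ Finset.Ico k₀ k, M ^ j / M ^ k ≤ 2 / M := by
  have h0 : 0 < M := by linarith
  rw [← Finset.sum_div, div_le_div_iff₀ (by positivity) h0]
  have h1 : ∑ j ∈ Finset.Ico k₀ k, M ^ j ≤ ∑ j ∈ Finset.range k, M ^ j := by
    refine Finset.sum_le_sum_of_subset_of_nonneg (fun j hj => ?_) fun j _ _ => by positivity
    simpa using (Finset.mem_Ico.mp hj).2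
  have h2 := geom_sum_mul M k
  have h3 : 0 ≤ ∑ j ∈ Finset.range k, M ^ j := Finset.sum_nonneg fun j _ => by positivity
  nlinarith

lemma sum_inv_geom_le {M : ℝ} (hM : 2 ≤ M) (k₀ k : ℕ) :
    ∑ j ∈ Finset.Ico k₀ k, 1 / M ^ j ≤ 2 / M ^ k₀ := by
  have h0 : 0 < M := by linarith
  have h2 : M⁻¹ ≤ 1 / 2 := by rw [one_div]; exact inv_anti₀ two_pos hM
  have h := geom_sum_Ico_le_of_lt_one (x := M⁻¹) (m := k₀) (n := k) (by positivity) (by linarith)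
  simp only [inv_pow] at h
  simp only [one_div]
  refine h.trans ?_
  rw [div_eq_mul_inv, div_eq_mul_inv, mul_comm]
  gcongr
  rw [inv_le_comm₀ (by linarith) two_pos]
  linarith

/-- The balls around the children of the levels `j < k`, enlarged by the spacing of level `k`,
occupy a small part of the ball. -/
lemma sum_enlarged_children_le {d : ℕ} (hd : d ≠ 0) {ψ : ℕ → ℝ} (hψ : ∀ q, 1 ≤ q → 0 < ψ q)
    {B : ℝ} (hψB : ∀ q : ℕ, B ≤ q → 2 * (q : ℝ) ^ 3 * ψ q ≤ 1)
    {z : Fin d → ℝ} {r : ℝ} {P : ℕ} (hr : 0 < r) {k₀ : ℕ}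
    (hfine : ∀ k ≥ k₀, IsFine d r B (levelBase d ^ k))
    {S : ℕ → Finset (Fin d → ℝ)} {k : ℕ}
    (hS : ∀ j ∈ Finset.Ico k₀ k, ∀ a ∈ S j, IsChild ψ z r P (levelBase d ^ j) a)
    (hsep : ∀ j ∈ Finset.Ico k₀ k, ∀ a ∈ S j, ∀ b ∈ S j, a ≠ b →
      3 * spacing d (levelBase d ^ j) ≤ dist a b) :
    ∑ j ∈ Finset.Ico k₀ k, ∑ a ∈ S j,
      (ψ (vecDen a) + 3 * spacing d (levelBase d ^ k) / denRatio d) ^ d ≤ badRatio d * r ^ d := by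
  have hδ := denRatio_pos d
  have hδ1 := denRatio_le_one d
  have hκ := badRatio_pos d
  have hκ1 := badRatio_le_one d
  have hM2 : (2 : ℝ) ≤ levelBase d := by exact_mod_cast two_le_levelBase d
  have hM12 := le_levelBase d
  set M : ℝ := (levelBase d : ℝ) with hM
  have hM0 : 0 < M := by linarith
  have hδM : 3 / denRatio d / M ≤ badRatio d / 4 := by
    rw [div_le_iff₀ (by positivity)] at hM12
    rw [div_div, div_le_iff₀ (by positivity)]
    linarith
  -- By separation level `j` has at most `(r / τ) ^ d` children, and each enlarged radius is at most
  -- `τ * x` with `x ≤ 1`, so `x ^ d ≤ x`. What remains are two geometric series in `j`, each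
  -- contributing at most `badRatio d / 2`.
  have hterm : ∀ j ∈ Finset.Ico k₀ k, ∑ a ∈ S j,
      (ψ (vecDen a) + 3 * spacing d (levelBase d ^ k) / denRatio d) ^ d ≤
      r ^ d * (1 / (2 * denRatio d ^ 3) * (1 / M ^ j) + 3 / denRatio d * (M ^ j / M ^ k)) := by
    intro j hj
    obtain ⟨hj0, hjk⟩ := Finset.mem_Ico.mp hj
    have hfj := hfine j hj0
    set τ := spacing d (levelBase d ^ j) with hτ
    have hτ0 : 0 < τ := spacing_pos hfj.one_le
    set x := 1 / (2 * denRatio d ^ 3) * (1 / M ^ j) + 3 / denRatio d * (M ^ j / M ^ k) with hx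
    have hx0 : 0 ≤ x := by positivity
    have hMjk : M ^ j / M ^ k ≤ 1 / M := by
      rw [div_le_div_iff₀ (by positivity) hM0, one_mul, ← pow_succ]
      exact pow_le_pow_right₀ (by linarith) hjk
    have hx1 : x ≤ 1 := by
      have h1 := hfj.ratio_small
      push_cast at h1
      rw [← hM] at h1
      have h2 : 3 / denRatio d * (M ^ j / M ^ k) ≤ 3 / denRatio d * (1 / M) := by gcongr
      have h3 : 1 / (2 * denRatio d ^ 3) * (1 / M ^ j) = 1 / (2 * denRatio d ^ 3 * M ^ j) := by
        rw [div_mul_div_comm, one_mul]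
      have h4 : 3 / denRatio d * (1 / M) = 3 / denRatio d / M := by ring
      rw [hx, h3]
      linarith
    have hsp : spacing d (levelBase d ^ k) ≤ τ * (M ^ j / M ^ k) := by
      have e : spacing d (levelBase d ^ k) = τ * (M ^ j / M ^ k) ^ (d + 1) := by
        rw [hτ, spacing, spacing]
        push_cast
        rw [← hM, div_pow]
        field_simp
      rw [e]
      gcongr
      refine pow_le_of_le_one (by positivity) (hMjk.trans ?_) (by omega)
      rw [div_le_one hM0]; linarith
    have hrad : ∀ a ∈ S j, (ψ (vecDen a) + 3 * spacing d (levelBase d ^ k) / denRatio d) ^ d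
        ≤ τ ^ d * x := by
      intro a ha
      have h1 := (hS j hj a ha).psi_le hd hψB hfj
      push_cast at h1
      rw [← hM, ← hτ] at h1
      have hψa := hψ _ (hS j hj a ha).one_le
      have hsk : 0 < spacing d (levelBase d ^ k) := spacing_pos (hfine k (by omega)).one_le
      have h2 : ψ (vecDen a) + 3 * spacing d (levelBase d ^ k) / denRatio d ≤ τ * x := by
        have h3 : 3 * spacing d (levelBase d ^ k) / denRatio d ≤
            3 * (τ * (M ^ j / M ^ k)) / denRatio d := by gcongr
        have e1 : τ * x = τ * (1 / (2 * denRatio d ^ 3 * M ^ j)) +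
            3 * (τ * (M ^ j / M ^ k)) / denRatio d := by
          rw [hx]; field_simp
        linarith
      calc _ ≤ (τ * x) ^ d := by gcongr
        _ = τ ^ d * x ^ d := mul_pow _ _ _
        _ ≤ τ ^ d * x := by
          gcongr
          exact pow_le_of_le_one hx0 hx1 hd
    have hcard : ((S j).card : ℝ) * τ ^ d ≤ r ^ d := by
      have h1 := card_le_of_separated (S j) (z := z) (R := r) (σ := 3 * τ) hr.le (by positivity)
        (fun a ha => by have := (hS j hj a ha).dist_le; linarith) (hsep j hj)
      have h2 : τ ≤ r / 4 := hfj.spacing_le_self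
      calc _ ≤ (2 * r / (3 * τ) + 1) ^ d * τ ^ d := by gcongr
        _ = (2 * r / 3 + τ) ^ d := by rw [← mul_pow]; congr 1; field_simp
        _ ≤ r ^ d := by gcongr; linarith
    calc _ ≤ ∑ a ∈ S j, τ ^ d * x := Finset.sum_le_sum hrad
      _ = (S j).card * τ ^ d * x := by rw [Finset.sum_const, nsmul_eq_mul]; ring
      _ ≤ r ^ d * x := by gcongr
  refine (Finset.sum_le_sum hterm).trans ?_
  rw [← Finset.mul_sum, Finset.sum_add_distrib, ← Finset.mul_sum, ← Finset.mul_sum, mul_comm]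
  gcongr
  have h1 : 1 / (2 * denRatio d ^ 3) * ∑ j ∈ Finset.Ico k₀ k, 1 / M ^ j ≤
      1 / (2 * denRatio d ^ 3) * (2 / M ^ k₀) := by
    gcongr; exact sum_inv_geom_le hM2 _ _
  have h2 : 3 / denRatio d * ∑ j ∈ Finset.Ico k₀ k, M ^ j / M ^ k ≤ 3 / denRatio d * (2 / M) := by
    gcongr; exact sum_geom_le hM2 _ _
  have h3 := (hfine k₀ le_rfl).ratio_small
  push_cast at h3
  rw [← hM] at h3
  have e1 : 1 / (2 * denRatio d ^ 3) * (2 / M ^ k₀) = 2 * (1 / (2 * denRatio d ^ 3 * M ^ k₀)) := by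
    field_simp
  have e2 : 3 / denRatio d * (2 / M) = 2 * (3 / denRatio d / M) := by field_simp
  linarith

/-- Children on finitely many consecutive levels, well separated within and across levels. -/
structure IsFamily {d : ℕ} (ψ : ℕ → ℝ) (z : Fin d → ℝ) (r : ℝ) (P k₀ K : ℕ)
    (S : ℕ → Finset (Fin d → ℝ)) : Prop where
  isChild : ∀ k ∈ Finset.Ico k₀ K, ∀ a ∈ S k, IsChild ψ z r P (levelBase d ^ k) a
  sep : ∀ k ∈ Finset.Ico k₀ K, ∀ a ∈ S k, ∀ b ∈ S k, a ≠ b →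
    3 * spacing d (levelBase d ^ k) ≤ dist a b
  cross : ∀ k ∈ Finset.Ico k₀ K, ∀ j ∈ Finset.Ico k₀ k, ∀ a ∈ S k, ∀ b ∈ S j,
    ψ (vecDen b) + 2 * spacing d (levelBase d ^ k) ≤ dist a b
  card : ∀ k ∈ Finset.Ico k₀ K, density d * r ^ d ≤ (S k).card * spacing d (levelBase d ^ k) ^ d

/-- Induction on the number of levels: the children already chosen, with their balls enlarged by the
new spacing, form the set `T` avoided in `exists_children_level`, and `sum_enlarged_children_le`
says that they leave enough room. -/
lemma exists_isFamily {d : ℕ} (hd : d ≠ 0) {ψ : ℕ → ℝ} (hψ : ∀ q, 1 ≤ q → 0 < ψ q)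
    {B : ℝ} (hψB : ∀ q : ℕ, B ≤ q → 2 * (q : ℝ) ^ 3 * ψ q ≤ 1)
    (z : Fin d → ℝ) {r : ℝ} {P : ℕ} (hr : 0 < r) (hr1 : r ≤ 1) (hP : 1 ≤ P)
    (hclean : IsClean d ψ r P) {k₀ : ℕ}
    (hfine : ∀ k ≥ k₀, IsFine d r B (levelBase d ^ k)) (K : ℕ) :
    ∃ S, IsFamily ψ z r P k₀ K S := by
  classical
  induction K with
  | zero => exact ⟨fun _ => ∅, by simp, by simp, by simp, by simp⟩
  | succ K ih =>
    obtain ⟨S, hS⟩ := ih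
    rcases lt_or_ge K k₀ with hK | hK
    · have he : Finset.Ico k₀ (K + 1) = ∅ := Finset.Ico_eq_empty (by omega)
      exact ⟨S, by simp [he], by simp [he], by simp [he], by simp [he]⟩
    have hf := hfine K hK
    have hsum := sum_enlarged_children_le hd hψ hψB hr hfine hS.isChild hS.sep
    obtain ⟨S', hS'1, hS'2, hS'3⟩ := exists_children_level hd hψ z hr hr1 hP hclean hf.one_le hf.big
      hf.inv_le hf.spacing_le ((Finset.Ico k₀ K).biUnion S) (fun a => ψ (vecDen a))
      (by
        intro a ha
        obtain ⟨j, hj, ha⟩ := Finset.mem_biUnion.mp ha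
        exact (hψ _ (hS.isChild j hj a ha).one_le).le)
      (by
        refine le_trans ?_ hsum
        have hpos : ∀ j ∈ Finset.Ico k₀ K, ∀ a ∈ S j,
            0 ≤ (ψ (vecDen a) + 3 * spacing d (levelBase d ^ K) / denRatio d) ^ d := by
          intro j hj a ha
          have h1 := hψ _ (hS.isChild j hj a ha).one_le
          have h2 := spacing_pos (d := d) hf.one_le
          have h3 := denRatio_pos d
          positivity
        -- The levels are not known to be disjoint, so the sum over their union is only bounded by
        -- the sum over the disjoint union.
        rw [Finset.sum_sigma']
        refine le_trans (Finset.sum_le_sum_of_subset_of_nonneg (t :=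
          ((Finset.Ico k₀ K).sigma S).image Sigma.snd) ?_ ?_) (Finset.sum_image_le_of_nonneg ?_)
        · intro a ha
          obtain ⟨j, hj, ha⟩ := Finset.mem_biUnion.mp ha
          exact Finset.mem_image.mpr ⟨⟨j, a⟩, Finset.mem_sigma.mpr ⟨hj, ha⟩, rfl⟩
        · intro a ha _
          obtain ⟨⟨j, b⟩, hj, rfl⟩ := Finset.mem_image.mp ha
          exact hpos j (Finset.mem_sigma.mp hj).1 b (Finset.mem_sigma.mp hj).2
        · intro a ha
          obtain ⟨⟨j, b⟩, hj, rfl⟩ := Finset.mem_image.mp ha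
          exact hpos j (Finset.mem_sigma.mp hj).1 b (Finset.mem_sigma.mp hj).2)
    have hIco : ∀ k ∈ Finset.Ico k₀ (K + 1), k = K ∨ (k ≠ K ∧ k ∈ Finset.Ico k₀ K) := by
      intro k hk
      simp only [Finset.mem_Ico] at hk ⊢
      omega
    have hne : ∀ k j, k ∈ Finset.Ico k₀ (K + 1) → j ∈ Finset.Ico k₀ k → j ≠ K := by
      intro k j hk hj
      simp only [Finset.mem_Ico] at hk hj
      omega
    refine ⟨Function.update S K S', ?_, ?_, ?_, ?_⟩
    · intro k hk
      rcases hIco k hk with rfl | ⟨hkK, hk⟩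
      · simpa using fun a ha => (hS'1 a ha).1
      · simpa [hkK] using hS.isChild k hk
    · intro k hk
      rcases hIco k hk with rfl | ⟨hkK, hk⟩
      · simpa using hS'2
      · simpa [hkK] using hS.sep k hk
    · intro k hk j hj a ha b hb
      rw [Function.update_of_ne (hne k j hk hj)] at hb
      rcases hIco k hk with rfl | ⟨hkK, hk⟩
      · rw [Function.update_self] at ha
        exact (hS'1 a ha).2 b (Finset.mem_biUnion.mpr ⟨j, hj, hb⟩)
      · rw [Function.update_of_ne hkK] at ha
        exact hS.cross k hk j hj a ha b hb
    · intro k hk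
      rcases hIco k hk with rfl | ⟨hkK, hk⟩
      · simpa using hS'3
      · simpa [hkK] using hS.card k hk

/-! ### Thresholds, cleanness and shell balls -/

lemma sum_Ico_inv_sq_le {P : ℕ} (hP : 1 ≤ P) (m : ℕ) :
    ∑ n ∈ Finset.Ico P m, 1 / (n : ℝ) ^ 2 ≤ 2 / (P : ℝ) := by
  have h := sum_Ioo_inv_sq_le (α := ℝ) (P - 1) m
  have e : Finset.Ioo (P - 1) m = Finset.Ico P m := by
    ext n; simp only [Finset.mem_Ioo, Finset.mem_Ico]; omega
  rw [e] at h
  push_cast [hP] at h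
  simpa [one_div] using h

/-- The threshold of denominators below which a ball close to a rational vector with denominator
`q` meets no other rational vector. -/
noncomputable def nextDen (ψ : ℕ → ℝ) (q : ℕ) : ℕ := ⌈1 / (2 * q * ψ q)⌉₊

lemma sq_le_nextDen {ψ : ℕ → ℝ} {q : ℕ} (hq : 1 ≤ q) (hψ : 0 < ψ q)
    (h : 2 * (q : ℝ) ^ 3 * ψ q ≤ 1) : q ^ 2 ≤ nextDen ψ q := by
  have hq0 : (0 : ℝ) < q := by exact_mod_cast hq
  have h1 : ((q ^ 2 : ℕ) : ℝ) ≤ 1 / (2 * q * ψ q) := by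
    rw [le_div_iff₀ (by positivity)]; push_cast; linarith
  exact Nat.cast_le.mp (h1.trans (Nat.le_ceil _))

/-- Beyond the threshold `1 ≤ 2 * q * ψ q * n`, so the `+ 1` in the counting factor costs only a
factor of order `q / ε`. With `ψ n ≤ 1 / (2 * n ^ 3)` the terms are at most `r ^ d * 24 * q / (ε * n
^ 2)`. As the threshold is at least `q ^ 2`, their sum is at most `r ^ d * 48 / (ε * q)`. -/
lemma isClean_nextDen {d : ℕ} (hd : d ≠ 0) {ψ : ℕ → ℝ} (hψ : ∀ q, 1 ≤ q → 0 < ψ q)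
    {B : ℝ} (hψB : ∀ q : ℕ, B ≤ q → 2 * (q : ℝ) ^ 3 * ψ q ≤ 1) {ε : ℝ} (hε : 0 < ε) (hε1 : ε < 1)
    {q : ℕ} (hq : 1 ≤ q) (hBq : B ≤ q) (hεq : 48 / (ε * badRatio d) ≤ q) :
    IsClean d ψ (ε * ψ q / 4) (nextDen ψ q) := by
  intro m
  have hq0 : (0 : ℝ) < q := by exact_mod_cast hq
  have hq1 : (1 : ℝ) ≤ q := by exact_mod_cast hq
  have hψq := hψ q hq
  have hκ := badRatio_pos d
  have hκ1 := badRatio_le_one d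
  have hsq := sq_le_nextDen hq hψq (hψB q hBq)
  set P := nextDen ψ q with hP
  have hsq' : (q : ℝ) ^ 2 ≤ P := by exact_mod_cast hsq
  have hqP : (q : ℝ) ≤ P := by nlinarith
  have hP1 : 1 ≤ P := by
    have : (1 : ℝ) ≤ P := hq1.trans hqP
    exact_mod_cast this
  have h48 : 48 ≤ badRatio d * (ε * q) := by
    rw [div_le_iff₀ (by positivity)] at hεq; linarith
  set r := ε * ψ q / 4 with hr
  have hr0 : 0 < r := by positivity
  have hterm : ∀ n ∈ Finset.Ico P m, (2 * r * n + 1) ^ d * (4 * ψ n) ^ d ≤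
      r ^ d * (24 * q / ε * (1 / (n : ℝ) ^ 2)) := by
    intro n hn
    have hPn : (P : ℝ) ≤ n := by exact_mod_cast (Finset.mem_Ico.mp hn).1
    have hn1 : 1 ≤ n := hP1.trans (Finset.mem_Ico.mp hn).1
    have hn0 : (0 : ℝ) < n := by exact_mod_cast hn1
    have hψn := hψ n hn1
    have h1 : 1 ≤ 2 * q * ψ q * n := by
      have := (Nat.le_ceil (1 / (2 * q * ψ q))).trans hPn
      rw [div_le_iff₀ (by positivity)] at this
      linarith
    have h2 : 2 * r * n + 1 ≤ 12 * q / ε * r * n := by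
      have e : 12 * q / ε * r * n = 3 * q * ψ q * n := by rw [hr]; field_simp; ring
      rw [e, hr]
      have : ε * (ψ q * n) ≤ q * (ψ q * n) := by gcongr; linarith
      have : 0 < q * ψ q * n := by positivity
      nlinarith
    have h3 : 4 * ψ n ≤ 2 / (n : ℝ) ^ 3 := by
      rw [le_div_iff₀ (by positivity)]
      linarith [hψB n (hBq.trans (hqP.trans hPn))]
    have h4 : (2 * r * n + 1) * (4 * ψ n) ≤ r * (24 * q / ε * (1 / (n : ℝ) ^ 2)) := by
      calc _ ≤ 12 * q / ε * r * n * (2 / (n : ℝ) ^ 3) := by gcongr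
        _ = _ := by field_simp; ring
    have h5 : 24 * q / ε * (1 / (n : ℝ) ^ 2) ≤ 1 := by
      rw [div_mul_div_comm, mul_one, div_le_one (by positivity)]
      have h6 : (q : ℝ) ^ 2 * q ^ 2 ≤ (n : ℝ) ^ 2 := by
        have : (q : ℝ) ^ 2 ≤ n := hsq'.trans hPn
        nlinarith [sq_nonneg (q : ℝ)]
      have h7 : 24 ≤ ε * q := by nlinarith [mul_pos hε hq0]
      have h8 : (q : ℝ) * 1 ≤ q * (q * q) := by gcongr; nlinarith
      calc 24 * (q : ℝ) ≤ (ε * q) * (q * (q * q)) := by gcongr; linarith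
        _ = ε * ((q : ℝ) ^ 2 * q ^ 2) := by ring
        _ ≤ ε * (n : ℝ) ^ 2 := by gcongr
    rw [← mul_pow]
    calc _ ≤ (r * (24 * q / ε * (1 / (n : ℝ) ^ 2))) ^ d := by gcongr
      _ = r ^ d * (24 * q / ε * (1 / (n : ℝ) ^ 2)) ^ d := mul_pow _ _ _
      _ ≤ _ := by
        gcongr
        exact pow_le_of_le_one (by positivity) h5 hd
  refine (Finset.sum_le_sum hterm).trans ?_
  rw [← Finset.mul_sum, ← Finset.mul_sum, mul_comm]
  gcongr
  calc 24 * q / ε * ∑ n ∈ Finset.Ico P m, 1 / (n : ℝ) ^ 2 ≤ 24 * q / ε * (2 / P) := by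
        gcongr; exact sum_Ico_inv_sq_le hP1 m
    _ ≤ 24 * q / ε * (2 / (q : ℝ) ^ 2) := by gcongr
    _ = 48 / (ε * q) := by field_simp; ring
    _ ≤ badRatio d := by rw [div_le_iff₀ (by positivity)]; exact h48

/-- The centre of the ball inside the shell around a child `a`. -/
noncomputable def shellCenter {d : ℕ} (ψ : ℕ → ℝ) (ε : ℝ) (a : Fin d → ℝ) : Fin d → ℝ :=
  a + fun _ => (1 - ε / 2) * ψ (vecDen a)

/-- A ball inside the shell of points at distance between `(1 - ε) ψ q` and `ψ q` from the rational
vector `a` with least denominator `q`. -/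
noncomputable def shellBall {d : ℕ} (ψ : ℕ → ℝ) (ε : ℝ) (a : Fin d → ℝ) : Set (Fin d → ℝ) :=
  closedBall (shellCenter ψ ε a) (ε * ψ (vecDen a) / 4)

/-- In the maximum norm the constant offset puts the centre at distance exactly `(1 - ε / 2) * ψ q`
from `a`, and the radius `ε * ψ q / 4` is half the distance to either boundary of the shell. -/
lemma dist_of_mem_shellBall {d : ℕ} (hd : d ≠ 0) {ψ : ℕ → ℝ} {ε : ℝ} (hε : 0 < ε) (hε1 : ε < 1)
    {a x : Fin d → ℝ} (hψ : 0 < ψ (vecDen a)) (hx : x ∈ shellBall ψ ε a) :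
    (1 - ε) * ψ (vecDen a) ≤ dist x a ∧ dist x a < ψ (vecDen a) := by
  have : Nonempty (Fin d) := ⟨⟨0, Nat.pos_of_ne_zero hd⟩⟩
  have h1 : dist (shellCenter ψ ε a) a = (1 - ε / 2) * ψ (vecDen a) := by
    rw [dist_eq_norm, shellCenter, add_sub_cancel_left, pi_norm_const, Real.norm_eq_abs,
      abs_of_pos (mul_pos (by linarith) hψ)]
  rw [shellBall, mem_closedBall] at hx
  have h2 := dist_triangle x (shellCenter ψ ε a) a
  have h3 := dist_triangle_left (shellCenter ψ ε a) a x
  have h4 : 0 < ε * ψ (vecDen a) := by positivity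
  constructor <;> nlinarith

lemma IsChild.shellBall_subset {d : ℕ} (hd : d ≠ 0) {ψ : ℕ → ℝ} (hψ : ∀ q, 1 ≤ q → 0 < ψ q)
    {B : ℝ} (hψB : ∀ q : ℕ, B ≤ q → 2 * (q : ℝ) ^ 3 * ψ q ≤ 1) {ε : ℝ} (hε : 0 < ε) (hε1 : ε < 1)
    {z : Fin d → ℝ} {r : ℝ} {P N : ℕ} {a : Fin d → ℝ} (h : IsChild ψ z r P N a)
    (hN : IsFine d r B N) : shellBall ψ ε a ⊆ closedBall z r := by
  intro x hx
  have h1 := (dist_of_mem_shellBall hd hε hε1 (hψ _ h.one_le) hx).2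
  have h2 := h.psi_le_spacing hd hψB hN
  have h3 := hN.spacing_le_self
  have h4 := h.dist_le
  have h5 := spacing_pos (d := d) hN.one_le
  rw [mem_closedBall]
  linarith [dist_triangle x a z]

/-- Points of the shell ball around a child are not too close to rational vectors with denominators
in `[P, nextDen ψ q)`. -/
lemma IsChild.le_dist_ratVec {d : ℕ} (hd : d ≠ 0) {ψ : ℕ → ℝ} (hψ : ∀ q, 1 ≤ q → 0 < ψ q)
    (hmono : AntitoneOn ψ (Set.Ici 1))
    {B : ℝ} (hB : 1 / denRatio d ≤ B) (hψB : ∀ q : ℕ, B ≤ q → 2 * (q : ℝ) ^ 3 * ψ q ≤ 1)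
    {ε : ℝ} (hε : 0 < ε) (hε1 : ε < 1)
    {z : Fin d → ℝ} {r : ℝ} {P N : ℕ} (hP : 1 ≤ P) {a : Fin d → ℝ} (h : IsChild ψ z r P N a)
    (hN : IsFine d r B N) {x : Fin d → ℝ} (hx : x ∈ shellBall ψ ε a) {n : ℕ} (hPn : P ≤ n)
    (hn : n < nextDen ψ (vecDen a)) (p : Fin d → ℤ) :
    (1 - ε) * ψ n ≤ dist x (ratVec p n) := by
  have hq1 := h.one_le
  have hn1 : 1 ≤ n := hP.trans hPn
  obtain ⟨pa, hpa⟩ := h.eq_ratVec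
  have hle := h.den_le
  have hlow := h.le_den
  have hψq := hψ _ hq1
  have hψn := hψ _ hn1
  obtain ⟨hx1, hx2⟩ := dist_of_mem_shellBall hd hε hε1 hψq hx
  have hδ := denRatio_pos d
  have hq0 : (0 : ℝ) < vecDen a := by exact_mod_cast hq1
  have hn0 : (0 : ℝ) < n := by exact_mod_cast hn1
  have h1ε : (1 - ε) * ψ n ≤ ψ n := mul_le_of_le_one_left hψn.le (by linarith)
  by_cases hab : a = ratVec p n
  · rw [← hab]
    have : ψ n ≤ ψ (vecDen a) := hmono hq1 hn1 (vecDen_le hn1 hab)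
    exact le_trans (mul_le_mul_of_nonneg_left this (by linarith)) hx1
  have hsep : 1 / ((vecDen a : ℝ) * n) ≤ dist a (ratVec p n) := by
    have := one_div_le_norm_ratVec_sub hq1 hn1 (hpa ▸ hab)
    rwa [← hpa, ← dist_eq_norm] at this
  have htri := dist_triangle_left a (ratVec p n) x
  -- From the denominator of `a` up to the threshold, the gap `1 / (q * n)` between distinct
  -- rationals is at least `2 * ψ q`. Below it, `far` handles denominators under `denRatio d * N ^
  -- d`; above that bound `n` is comparable to `q`, and the gap together with `2 * n ^ 3 * ψ n ≤ 1`
  -- suffices.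
  rcases le_or_gt (vecDen a) n with hqn | hqn
  · have h1 : ψ n ≤ ψ (vecDen a) := hmono hq1 hn1 hqn
    have h2 : (n : ℝ) < 1 / (2 * vecDen a * ψ (vecDen a)) := Nat.lt_ceil.mp hn
    have h3 : 2 * ψ (vecDen a) ≤ 1 / ((vecDen a : ℝ) * n) := by
      rw [lt_div_iff₀ (by positivity)] at h2
      rw [le_div_iff₀ (by positivity)]
      linarith
    linarith
  · have h1 : ψ (vecDen a) ≤ ψ n := hmono hn1 hq1 hqn.le
    have h2 : 2 * ψ n ≤ dist a (ratVec p n) := by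
      rcases lt_or_ge (n : ℝ) (denRatio d * (N : ℝ) ^ d) with hlt | hge
      · exact h.far n p hPn hlt
      · refine le_trans ?_ hsep
        have hBn := hN.le_den.trans hge
        have h3 := hψB n hBn
        have h4 : 1 ≤ denRatio d * n := by
          have := hB.trans hBn
          rw [div_le_iff₀ hδ] at this
          linarith
        have h5 : denRatio d * vecDen a ≤ n := by
          refine le_trans ?_ hge
          gcongr
          exact_mod_cast hle
        rw [le_div_iff₀ (by positivity)]
        calc 2 * ψ n * (vecDen a * n) ≤ 2 * ψ n * (vecDen a * n) * (denRatio d * n) :=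
              le_mul_of_one_le_right (by positivity) h4
          _ = 2 * ψ n * n ^ 2 * (denRatio d * vecDen a) := by ring
          _ ≤ 2 * ψ n * n ^ 2 * n := by gcongr
          _ = 2 * n ^ 3 * ψ n := by ring
          _ ≤ 1 := h3
    linarith

/-! ### Condensation and pigeonhole -/

/-- Condensation of a divergent sum along powers. -/
lemma exists_lt_sum_levels {d : ℕ} {ψ : ℕ → ℝ} (hψ : ∀ q, 1 ≤ q → 0 < ψ q)
    (hmono : AntitoneOn ψ (Set.Ici 1)) {s : ℝ} (hs : 0 < s) (hd : d ≠ 0)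
    (hdiv : ¬ Summable fun q : ℕ => (q : ℝ) ^ d * ψ q ^ s) {M : ℕ} (hM : 2 ≤ M) (k₀ : ℕ) (A : ℝ) :
    ∃ K, A < ∑ k ∈ Finset.Ico k₀ K, ψ ((M ^ k) ^ d) ^ s / spacing d (M ^ k) ^ d := by
  by_contra! hcon
  apply hdiv
  have hM0 : (0 : ℝ) < M := by exact_mod_cast (by omega : 0 < M)
  have hM1 : 1 ≤ M := by omega
  have hpos : ∀ k, 1 ≤ (M ^ k) ^ d := fun k => Nat.one_le_pow _ _ (Nat.pow_pos (by omega))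
  have hmonoM : Monotone fun k => (M ^ k) ^ d := fun a b hab =>
    Nat.pow_le_pow_left (Nat.pow_le_pow_right hM1 hab) d
  have hψnn : ∀ q : ℕ, 1 ≤ q → 0 ≤ (q : ℝ) ^ d * ψ q ^ s := fun q hq => by
    have := hψ q hq; positivity
  -- With `N = M ^ k`, a block has at most `(M * N) ^ d` terms, each at most `(M * N) ^ (d * d) * ψ
  -- (N ^ d) ^ s`, and `N ^ (d * (d + 1))` is `1 / spacing d N ^ d`.
  have hblock : ∀ k, ∑ q ∈ Finset.Ico ((M ^ k) ^ d) ((M ^ (k + 1)) ^ d), (q : ℝ) ^ d * ψ q ^ s ≤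
      (M : ℝ) ^ (d * (d + 1)) * (ψ ((M ^ k) ^ d) ^ s / spacing d (M ^ k) ^ d) := by
    intro k
    have h0 := hψ _ (hpos k)
    have hterm : ∀ q ∈ Finset.Ico ((M ^ k) ^ d) ((M ^ (k + 1)) ^ d), (q : ℝ) ^ d * ψ q ^ s ≤
        (((M : ℝ) ^ (k + 1)) ^ d) ^ d * ψ ((M ^ k) ^ d) ^ s := by
      intro q hq
      obtain ⟨hq1, hq2⟩ := Finset.mem_Ico.mp hq
      have hψq := hψ q ((hpos k).trans hq1)
      have h1 : ψ q ≤ ψ ((M ^ k) ^ d) := hmono (hpos k) ((hpos k).trans hq1) hq1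
      have h2 : (q : ℝ) ≤ ((M : ℝ) ^ (k + 1)) ^ d := by exact_mod_cast hq2.le
      gcongr
    refine (Finset.sum_le_sum hterm).trans ?_
    rw [Finset.sum_const, nsmul_eq_mul, Nat.card_Ico]
    have hc : (((M ^ (k + 1)) ^ d - (M ^ k) ^ d : ℕ) : ℝ) ≤ ((M : ℝ) ^ (k + 1)) ^ d := by
      have : (M ^ (k + 1)) ^ d - (M ^ k) ^ d ≤ (M ^ (k + 1)) ^ d := Nat.sub_le _ _
      exact_mod_cast this
    calc _ ≤ ((M : ℝ) ^ (k + 1)) ^ d * ((((M : ℝ) ^ (k + 1)) ^ d) ^ d * ψ ((M ^ k) ^ d) ^ s) := by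
          gcongr
      _ = _ := by
        rw [spacing, one_div, inv_pow, div_inv_eq_mul]
        push_cast
        ring
  have hsum : ∀ K, k₀ ≤ K → ∑ q ∈ Finset.Ico ((M ^ k₀) ^ d) ((M ^ K) ^ d), (q : ℝ) ^ d * ψ q ^ s ≤
      (M : ℝ) ^ (d * (d + 1)) *
        ∑ k ∈ Finset.Ico k₀ K, ψ ((M ^ k) ^ d) ^ s / spacing d (M ^ k) ^ d := by
    intro K hK
    induction K, hK using Nat.le_induction with
    | base => simp
    | succ K hK ih =>
      rw [Finset.sum_Ico_succ_top hK, mul_add, ← Finset.sum_Ico_consecutive _ (hmonoM hK)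
        (hmonoM K.le_succ)]
      exact add_le_add ih (hblock K)
  rw [← summable_nat_add_iff ((M ^ k₀) ^ d)]
  refine summable_of_sum_range_le (c := (M : ℝ) ^ (d * (d + 1)) * A)
    (fun n => hψnn _ (by have := hpos k₀; omega)) fun n => ?_
  set K := k₀ + n
  have h1 : (M ^ k₀) ^ d + n ≤ (M ^ K) ^ d := by
    have h2 : n + 1 ≤ M ^ n := Nat.lt_pow_self (by omega)
    have h3 : n + 1 ≤ (M ^ n) ^ d := h2.trans (Nat.le_self_pow hd _)
    have e : (M ^ K) ^ d = (M ^ k₀) ^ d * (M ^ n) ^ d := by rw [← mul_pow, ← pow_add]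
    rw [e]
    nlinarith [hpos k₀]
  have h2 : ∑ i ∈ Finset.range n, (fun q : ℕ => (q : ℝ) ^ d * ψ q ^ s) (i + (M ^ k₀) ^ d) =
      ∑ q ∈ Finset.Ico ((M ^ k₀) ^ d) ((M ^ k₀) ^ d + n), (q : ℝ) ^ d * ψ q ^ s := by
    rw [Finset.sum_Ico_eq_sum_range]
    simp only [add_tsub_cancel_left]
    exact Finset.sum_congr rfl fun i _ => by rw [add_comm]
  rw [h2]
  calc _ ≤ ∑ q ∈ Finset.Ico ((M ^ k₀) ^ d) ((M ^ K) ^ d), (q : ℝ) ^ d * ψ q ^ s := by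
        refine Finset.sum_le_sum_of_subset_of_nonneg (Finset.Ico_subset_Ico_right h1) ?_
        exact fun q hq _ => hψnn q ((hpos k₀).trans (Finset.mem_Ico.mp hq).1)
    _ ≤ _ := hsum K (by omega)
    _ ≤ _ := by gcongr; exact hcon K

open Classical in
/-- Pigeonhole principle: if the masses `h i` hit the sets of a finite family `T` only few times,
then some member of the family is hit by little mass. -/
lemma exists_tsum_hit_lt {ι : Type*} (T : Finset ι) (w : ι → ℝ) (hw : ∀ t ∈ T, 0 < w t)
    (hit : ι → ℕ → Prop) (h : ℕ → ℝ) (hh : ∀ i, 0 ≤ h i) (hsum : Summable h) {α : ℝ}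
    (hα : ∀ i, ∑ t ∈ T, (if hit t i then min (h i) (w t) else 0) ≤ α * h i)
    (hlt : α * ∑' i, h i < ∑ t ∈ T, w t) :
    ∃ t ∈ T, ∑' i, (if hit t i then h i else 0) < w t := by
  by_contra! hcon
  have hnn : ∀ t ∈ T, ∀ i, 0 ≤ if hit t i then min (h i) (w t) else 0 := fun t ht i => by
    split_ifs
    · exact le_min (hh i) (hw t ht).le
    · exact le_rfl
  have hle : ∀ t i, (if hit t i then min (h i) (w t) else 0) ≤ h i := fun t i => by
    split_ifs
    · exact min_le_left _ _
    · exact hh i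
  have hs : ∀ t ∈ T, Summable fun i => if hit t i then min (h i) (w t) else 0 := fun t ht =>
    Summable.of_nonneg_of_le (hnn t ht) (hle t) hsum
  have hwt : ∀ t ∈ T, w t ≤ ∑' i, if hit t i then min (h i) (w t) else 0 := by
    intro t ht
    -- Truncation loses nothing: either one truncated term already equals `w t`, or no hitting term
    -- is truncated and `hcon` applies.
    by_cases hex : ∃ i, hit t i ∧ w t ≤ h i
    · obtain ⟨i, hi, hwi⟩ := hex
      refine le_trans ?_ ((hs t ht).le_tsum i fun j _ => hnn t ht j)
      rw [if_pos hi, min_eq_right hwi]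
    · push Not at hex
      refine (hcon t ht).trans_eq (tsum_congr fun i => ?_)
      split_ifs with hi
      · exact (min_eq_left (hex i hi).le).symm
      · rfl
  have h1 : ∑ t ∈ T, w t ≤ ∑' i, ∑ t ∈ T, if hit t i then min (h i) (w t) else 0 := by
    rw [Summable.tsum_finsetSum hs]
    exact Finset.sum_le_sum hwt
  have h2 : ∑' i, ∑ t ∈ T, (if hit t i then min (h i) (w t) else 0) ≤ ∑' i, α * h i :=
    (summable_sum hs).tsum_le_tsum hα (hsum.mul_left α)
  rw [tsum_mul_left] at h2
  linarith

/-! ### Hit mass and the main step -/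

/-- A sequence of sets together with positive bounds for their diameters whose `s`-th powers are
summable. -/
structure IsSummableCover {X : Type*} [PseudoMetricSpace X] (U : ℕ → Set X) (ρ : ℕ → ℝ) (s : ℝ) :
    Prop where
  pos : ∀ i, 0 < ρ i
  dist_le : ∀ i, ∀ x ∈ U i, ∀ y ∈ U i, dist x y ≤ ρ i
  summable : Summable fun i => ρ i ^ s

open Classical in
/-- The sum of the `ρ i ^ s` over those `i` for which `U i` meets `L`. -/
noncomputable def hitMass {X : Type*} (U : ℕ → Set X) (ρ : ℕ → ℝ) (s : ℝ) (L : Set X) : ℝ :=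
  ∑' i, if (U i ∩ L).Nonempty then ρ i ^ s else 0

/-- Used twice: a ball of small hit mass is met only by small sets, and a set meeting all the nested
balls would have `ρ i ^ s ≤ 0`. -/
lemma rpow_le_hitMass {X : Type*} [PseudoMetricSpace X] {U : ℕ → Set X} {ρ : ℕ → ℝ} {s : ℝ}
    (hU : IsSummableCover U ρ s) {L : Set X} {i : ℕ} (hi : (U i ∩ L).Nonempty) :
    ρ i ^ s ≤ hitMass U ρ s L := by
  classical
  have hnn : ∀ j, 0 ≤ if (U j ∩ L).Nonempty then ρ j ^ s else 0 := fun j => by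
    have := Real.rpow_nonneg (hU.pos j).le s
    split_ifs <;> simp [this]
  have hs : Summable fun j => if (U j ∩ L).Nonempty then ρ j ^ s else 0 :=
    Summable.of_nonneg_of_le hnn (fun j => by
      have := Real.rpow_nonneg (hU.pos j).le s
      split_ifs <;> simp [this]) hU.summable
  refine le_trans ?_ (hs.le_tsum i fun j _ => hnn j)
  rw [if_pos hi]

/-- Two distinct children hit by the same set of diameter `ρ` belong to levels with spacing less
than `ρ`. -/
lemma IsFamily.spacing_lt {d : ℕ} (hd : d ≠ 0) {ψ : ℕ → ℝ} (hψ : ∀ q, 1 ≤ q → 0 < ψ q)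
    {B : ℝ} (hψB : ∀ q : ℕ, B ≤ q → 2 * (q : ℝ) ^ 3 * ψ q ≤ 1) {ε : ℝ} (hε : 0 < ε) (hε1 : ε < 1)
    {z : Fin d → ℝ} {r : ℝ} {P k₀ K : ℕ}
    (hfine : ∀ k ≥ k₀, IsFine d r B (levelBase d ^ k)) {S : ℕ → Finset (Fin d → ℝ)}
    (hS : IsFamily ψ z r P k₀ K S) {V : Set (Fin d → ℝ)} {ρ : ℝ}
    (hV : ∀ x ∈ V, ∀ y ∈ V, dist x y ≤ ρ) {j k : ℕ} (hjk : j ≤ k) (hj : j ∈ Finset.Ico k₀ K)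
    (hk : k ∈ Finset.Ico k₀ K) {a b : Fin d → ℝ} (ha : a ∈ S k) (hb : b ∈ S j)
    (hne : j = k → a ≠ b) (hVa : (V ∩ shellBall ψ ε a).Nonempty)
    (hVb : (V ∩ shellBall ψ ε b).Nonempty) : spacing d (levelBase d ^ k) < ρ := by
  obtain ⟨x, hxV, hx⟩ := hVa
  obtain ⟨y, hyV, hy⟩ := hVb
  have hca := hS.isChild k hk a ha
  have hcb := hS.isChild j hj b hb
  have hfk := hfine k (Finset.mem_Ico.mp hk).1
  have h1 := (dist_of_mem_shellBall hd hε hε1 (hψ _ hca.one_le) hx).2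
  have h2 := (dist_of_mem_shellBall hd hε hε1 (hψ _ hcb.one_le) hy).2
  have h3 := hV x hxV y hyV
  have h4 : dist a b ≤ dist x a + dist x y + dist y b := by
    have := dist_triangle4 a x y b
    rw [dist_comm a x] at this
    exact this
  have h5 := hca.psi_le_spacing hd hψB hfk
  have h6 := spacing_pos (d := d) hfk.one_le
  -- On one level the separation `3 τ` beats two radii of at most `τ / 4`. Across levels the coarser
  -- radius `ψ (vecDen b)` is built into `cross`, which leaves `2 τ` against `τ / 4`.
  rcases eq_or_lt_of_le hjk with h | h
  · subst h
    have := hS.sep j hj a ha b hb (hne rfl)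
    have := hcb.psi_le_spacing hd hψB hfk
    linarith
  · have := hS.cross k hk j (Finset.mem_Ico.mpr ⟨(Finset.mem_Ico.mp hj).1, h⟩) a ha b hb
    linarith

/-- A set of diameter `ρ` meets at most `(2 ρ / τ) ^ d` children of a level with spacing `τ ≤ ρ`. -/
lemma IsFamily.card_hit_le {d : ℕ} (hd : d ≠ 0) {ψ : ℕ → ℝ} (hψ : ∀ q, 1 ≤ q → 0 < ψ q)
    {B : ℝ} (hψB : ∀ q : ℕ, B ≤ q → 2 * (q : ℝ) ^ 3 * ψ q ≤ 1) {ε : ℝ} (hε : 0 < ε) (hε1 : ε < 1)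
    {z : Fin d → ℝ} {r : ℝ} {P k₀ K : ℕ}
    (hfine : ∀ k ≥ k₀, IsFine d r B (levelBase d ^ k)) {S : ℕ → Finset (Fin d → ℝ)}
    (hS : IsFamily ψ z r P k₀ K S) {V : Set (Fin d → ℝ)} {ρ : ℝ}
    (hV : ∀ x ∈ V, ∀ y ∈ V, dist x y ≤ ρ) {k : ℕ} (hk : k ∈ Finset.Ico k₀ K)
    (hρ : spacing d (levelBase d ^ k) ≤ ρ) (H : Finset (Fin d → ℝ)) (hHS : H ⊆ S k)
    (hH : ∀ a ∈ H, (V ∩ shellBall ψ ε a).Nonempty) :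
    (H.card : ℝ) ≤ (2 * ρ) ^ d / spacing d (levelBase d ^ k) ^ d := by
  have hfk := hfine k (Finset.mem_Ico.mp hk).1
  have hτ := spacing_pos (d := d) hfk.one_le
  set τ := spacing d (levelBase d ^ k)
  have hρ0 : 0 < ρ := hτ.trans_le hρ
  rcases H.eq_empty_or_nonempty with rfl | ⟨b, hb⟩
  · simp; positivity
  have hdist : ∀ a ∈ H, dist a b ≤ 3 / 2 * ρ := by
    intro a ha
    obtain ⟨x, hxV, hx⟩ := hH a ha
    obtain ⟨y, hyV, hy⟩ := hH b hb
    have hca := hS.isChild k hk a (hHS ha)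
    have hcb := hS.isChild k hk b (hHS hb)
    have h1 := (dist_of_mem_shellBall hd hε hε1 (hψ _ hca.one_le) hx).2
    have h2 := (dist_of_mem_shellBall hd hε hε1 (hψ _ hcb.one_le) hy).2
    have h3 := hV x hxV y hyV
    have h4 := dist_triangle4 a x y b
    rw [dist_comm a x] at h4
    have h5 := hca.psi_le_spacing hd hψB hfk
    have h6 := hcb.psi_le_spacing hd hψB hfk
    linarith
  refine (card_le_of_separated H (R := 3 / 2 * ρ) (σ := 3 * τ) (by positivity) (by positivity)
    hdist fun a ha b hb => hS.sep k hk a (hHS ha) b (hHS hb)).trans ?_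
  rw [← div_pow]
  gcongr
  have h1 : 1 ≤ ρ / τ := (one_le_div hτ).mpr hρ
  have e1 : 2 * (3 / 2 * ρ) / (3 * τ) = ρ / τ := by field_simp
  have e2 : 2 * ρ / τ = 2 * (ρ / τ) := by ring
  rw [e1, e2]
  linarith

/-- The main step: a ball that is hit by little mass contains the shell ball of a child that is hit
by little mass relative to its own radius. -/
lemma exists_child_hitMass_lt {d : ℕ} (hd : d ≠ 0) {ψ : ℕ → ℝ} (hψ : ∀ q, 1 ≤ q → 0 < ψ q)
    (hmono : AntitoneOn ψ (Set.Ici 1)) {s : ℝ} (hs : 0 < s) (hsd : s < d)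
    (hdiv : ¬ Summable fun q : ℕ => (q : ℝ) ^ d * ψ q ^ s)
    {B : ℝ} (hψB : ∀ q : ℕ, B ≤ q → 2 * (q : ℝ) ^ 3 * ψ q ≤ 1)
    {U : ℕ → Set (Fin d → ℝ)} {ρ : ℕ → ℝ} (hU : IsSummableCover U ρ s)
    {z : Fin d → ℝ} {r : ℝ} {P : ℕ} (hr : 0 < r) (hr1 : r ≤ 1) (hP : 1 ≤ P)
    (hclean : IsClean d ψ r P) {ρm M' : ℝ}
    (hρm : ∀ i, (U i ∩ closedBall z r).Nonempty → ρ i ≤ ρm) (hρm0 : 0 ≤ ρm)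
    (hM' : hitMass U ρ s (closedBall z r) ≤ M')
    (hsmall : 2 ^ d * ρm ^ ((d : ℝ) - s) * M' ≤ density d * r ^ d / 2)
    {c : ℝ} (hc : 0 < c) {ε : ℝ} (hε : 0 < ε) (hε1 : ε < 1) (q₀ : ℝ) :
    ∃ (N : ℕ) (a : Fin d → ℝ), IsFine d r (max B q₀) N ∧ IsChild ψ z r P N a ∧
      hitMass U ρ s (shellBall ψ ε a) < c * (ε * ψ (vecDen a) / 4) ^ s := by
  classical
  have hM2 := two_le_levelBase d
  obtain ⟨k₀, hk₀⟩ := exists_isFine hd hr (max B q₀)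
  have hfine : ∀ k ≥ k₀, IsFine d r (max B q₀) (levelBase d ^ k) := fun k hk =>
    hk₀ _ (hk.trans (Nat.lt_pow_self (by omega)).le)
  have hψB' : ∀ q : ℕ, max B q₀ ≤ q → 2 * (q : ℝ) ^ 3 * ψ q ≤ 1 := fun q hq =>
    hψB q ((le_max_left _ _).trans hq)
  -- Enough levels that half of the total weight of the children exceeds `M'`.
  obtain ⟨K, hK⟩ := exists_lt_sum_levels hψ hmono hs hd hdiv hM2 k₀
    (2 * M' / (c * (ε / 4) ^ s * (density d * r ^ d)))
  obtain ⟨S, hS⟩ := exists_isFamily hd hψ hψB' z hr hr1 hP hclean hfine K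
  set τ : ℕ → ℝ := fun k => spacing d (levelBase d ^ k) with hτdef
  have hτ : ∀ k ∈ Finset.Ico k₀ K, 0 < τ k := fun k hk =>
    spacing_pos (hfine k (Finset.mem_Ico.mp hk).1).one_le
  have hone : ∀ k, 1 ≤ (levelBase d ^ k) ^ d := fun k =>
    Nat.one_le_pow _ _ (Nat.pow_pos (by omega))
  -- The weight uses the largest denominator allowed on the level, so it depends on the level only;
  -- by monotonicity it is at most the weight wanted for each child.
  set w : ℕ → ℝ := fun k => c * (ε * ψ ((levelBase d ^ k) ^ d) / 4) ^ s with hw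
  have hw0 : ∀ k, 0 < w k := fun k => by
    have := hψ _ (hone k)
    simp only [hw]
    positivity
  set W := ∑ k ∈ Finset.Ico k₀ K, w k / τ k ^ d with hW
  have hdens := density_pos d
  have hWbig : 2 * M' < density d * r ^ d * W := by
    have e : W = c * (ε / 4) ^ s *
        ∑ k ∈ Finset.Ico k₀ K, ψ ((levelBase d ^ k) ^ d) ^ s / τ k ^ d := by
      rw [hW, Finset.mul_sum]
      refine Finset.sum_congr rfl fun k _ => ?_
      have := hψ _ (hone k)
      have e1 : ε * ψ ((levelBase d ^ k) ^ d) / 4 = ε / 4 * ψ ((levelBase d ^ k) ^ d) := by ring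
      simp only [hw]
      rw [e1, Real.mul_rpow (by positivity) this.le]
      ring
    rw [div_lt_iff₀ (by positivity)] at hK
    rw [e]
    linarith
  have hW0 : 0 ≤ W := Finset.sum_nonneg fun k hk => by
    have := hw0 k; have := hτ k hk; positivity
  set L := closedBall z r with hL
  set h : ℕ → ℝ := fun i => if (U i ∩ L).Nonempty then ρ i ^ s else 0 with hh
  have hρs : ∀ i, 0 < ρ i ^ s := fun i => Real.rpow_pos_of_pos (hU.pos i) s
  have hh0 : ∀ i, 0 ≤ h i := fun i => by
    simp only [hh]; split_ifs
    exacts [(hρs i).le, le_rfl]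
  have hhs : Summable h := Summable.of_nonneg_of_le hh0 (fun i => by
    simp only [hh]; split_ifs
    exacts [le_rfl, (hρs i).le]) hU.summable
  set T := (Finset.Ico k₀ K).sigma S with hT
  have hsub : ∀ k ∈ Finset.Ico k₀ K, ∀ a ∈ S k, shellBall ψ ε a ⊆ L := fun k hk a ha =>
    (hS.isChild k hk a ha).shellBall_subset hd hψ hψB' hε hε1 (hfine k (Finset.mem_Ico.mp hk).1)
  set hit : (_ : ℕ) × (Fin d → ℝ) → ℕ → Prop := fun t i => (U i ∩ shellBall ψ ε t.2).Nonempty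
    with hhit
  -- In `α` the first summand counts the children of spacing at most `ρ i`, each bounded by its
  -- weight, using `ρ i ^ d ≤ ρm ^ (d - s) * ρ i ^ s`. The `+ 1` is the single child of larger
  -- spacing that `U i` can meet, bounded by `h i`.
  obtain ⟨⟨k, a⟩, hka, hlt⟩ := exists_tsum_hit_lt T (fun t => w t.1) (fun t _ => hw0 t.1) hit h hh0
    hhs (α := 2 ^ d * ρm ^ ((d : ℝ) - s) * W + 1) (by
      intro i
      by_cases hiL : (U i ∩ L).Nonempty
      swap
      · have h0 : h i = 0 := if_neg hiL
        rw [h0, mul_zero]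
        refine (Finset.sum_eq_zero fun t ht => ?_).le
        obtain ⟨hk, ha⟩ := Finset.mem_sigma.mp ht
        exact if_neg fun hn => hiL (hn.mono (inter_subset_inter_right _ (hsub _ hk _ ha)))
      have hi : h i = ρ i ^ s := if_pos hiL
      have hρi := hU.pos i
      rw [hi, ← Finset.sum_filter_add_sum_filter_not T (fun t => τ t.1 ≤ ρ i), add_mul, one_mul]
      refine add_le_add ?_ ?_
      · have h1 : ∑ t ∈ T with τ t.1 ≤ ρ i, (if hit t i then min (ρ i ^ s) (w t.1) else 0) ≤
            ∑ k ∈ Finset.Ico k₀ K, (2 * ρ i) ^ d * (w k / τ k ^ d) := by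
          rw [Finset.sum_filter, Finset.sum_sigma]
          refine Finset.sum_le_sum fun k hk => ?_
          have hwk := hw0 k
          have hτk := hτ k hk
          by_cases hle : τ k ≤ ρ i
          · simp only [hle, if_true]
            rw [← Finset.sum_filter]
            have hcard := hS.card_hit_le hd hψ hψB' hε hε1 hfine (hU.dist_le i) hk hle
              ((S k).filter fun a => hit ⟨k, a⟩ i) (Finset.filter_subset _ _)
              (fun a ha => (Finset.mem_filter.mp ha).2)
            calc _ ≤ ∑ a ∈ S k with hit ⟨k, a⟩ i, w k :=
                  Finset.sum_le_sum fun _ _ => min_le_right _ _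
              _ = ((S k).filter fun a => hit ⟨k, a⟩ i).card * w k := by
                  rw [Finset.sum_const, nsmul_eq_mul]
              _ ≤ (2 * ρ i) ^ d / τ k ^ d * w k := by gcongr
              _ = _ := by ring
          · simp only [hle, if_false, Finset.sum_const_zero]
            positivity
        refine h1.trans ?_
        rw [← Finset.mul_sum, ← hW]
        have h2 : ρ i ^ d ≤ ρm ^ ((d : ℝ) - s) * ρ i ^ s := by
          calc ρ i ^ d = ρ i ^ ((d : ℝ) - s) * ρ i ^ s := by
                rw [← Real.rpow_add hρi, sub_add_cancel, Real.rpow_natCast]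
            _ ≤ ρm ^ ((d : ℝ) - s) * ρ i ^ s :=
              mul_le_mul_of_nonneg_right
                (Real.rpow_le_rpow hρi.le (hρm i hiL) (sub_nonneg.mpr hsd.le)) (hρs i).le
        calc (2 * ρ i) ^ d * W = 2 ^ d * W * ρ i ^ d := by ring
          _ ≤ 2 ^ d * W * (ρm ^ ((d : ℝ) - s) * ρ i ^ s) := by gcongr
          _ = _ := by ring
      · rw [← Finset.sum_filter]
        set F := (T.filter fun t => ¬ τ t.1 ≤ ρ i).filter fun t => hit t i with hF
        have hcard : F.card ≤ 1 := by
          have key : ∀ t ∈ F, ∀ u ∈ F, t.1 ≤ u.1 → t = u := by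
            rintro ⟨j, b⟩ ht ⟨k, a⟩ hu hjk
            simp only [hF, hT, Finset.mem_filter, Finset.mem_sigma] at ht hu
            by_contra hne
            exact hu.1.2 (hS.spacing_lt hd hψ hψB' hε hε1 hfine (hU.dist_le i) hjk ht.1.1.1
              hu.1.1.1 hu.1.1.2 ht.1.1.2 (fun hjk hab => hne (by subst hjk hab; rfl)) hu.2 ht.2).le
          refine Finset.card_le_one.mpr fun t ht u hu => ?_
          rcases le_total t.1 u.1 with h | h
          · exact key t ht u hu h
          · exact (key u hu t ht h).symm
        calc _ ≤ ∑ t ∈ F, ρ i ^ s := Finset.sum_le_sum fun _ _ => min_le_left _ _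
          _ = F.card * ρ i ^ s := by rw [Finset.sum_const, nsmul_eq_mul]
          _ ≤ 1 * ρ i ^ s := by
            have := hρs i
            gcongr
            exact_mod_cast hcard
          _ = _ := one_mul _)
    (by
      have e : ∑' i, h i = hitMass U ρ s L := rfl
      have hρm1 : 0 ≤ ρm ^ ((d : ℝ) - s) := Real.rpow_nonneg hρm0 _
      have h1 : density d * r ^ d * W ≤ ∑ t ∈ T, w t.1 := by
        rw [hT, Finset.sum_sigma, hW, Finset.mul_sum]
        refine Finset.sum_le_sum fun k hk => ?_
        have hτk := hτ k hk
        have hwk := hw0 k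
        dsimp only
        rw [Finset.sum_const, nsmul_eq_mul]
        calc density d * r ^ d * (w k / τ k ^ d) ≤ (S k).card * τ k ^ d * (w k / τ k ^ d) :=
              mul_le_mul_of_nonneg_right (hS.card k hk) (by positivity)
          _ = _ := by field_simp
      -- Multiple hits consume at most half of the total weight, and `M'` is less than the other
      -- half.
      have h2 : 2 ^ d * ρm ^ ((d : ℝ) - s) * M' * W ≤ density d * r ^ d / 2 * W := by gcongr
      rw [e]
      calc _ ≤ (2 ^ d * ρm ^ ((d : ℝ) - s) * W + 1) * M' := by gcongr
        _ = 2 ^ d * ρm ^ ((d : ℝ) - s) * M' * W + M' := by ring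
        _ < _ := by linarith)
  obtain ⟨hk, ha⟩ := Finset.mem_sigma.mp hka
  have hchild := hS.isChild k hk a ha
  refine ⟨_, a, hfine k (Finset.mem_Ico.mp hk).1, hchild, ?_⟩
  have e : hitMass U ρ s (shellBall ψ ε a) = ∑' i, if hit ⟨k, a⟩ i then h i else 0 := by
    unfold hitMass
    refine tsum_congr fun i => ?_
    by_cases hi : (U i ∩ shellBall ψ ε a).Nonempty
    · have hi' : (U i ∩ L).Nonempty := hi.mono (inter_subset_inter_right _ (hsub k hk a ha))
      simp only [hhit, hh, hi, hi', if_true]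
    · simp only [hhit, hi, if_false]
  rw [e]
  refine hlt.trans_le ?_
  simp only [hw]
  have h1 : ψ ((levelBase d ^ k) ^ d) ≤ ψ (vecDen a) := hmono hchild.one_le (hone k) hchild.den_le
  have := hψ _ (hone k)
  gcongr

/-! ### The nested construction -/

/-- The closed ball with the threshold `P` is admissible: it is clean and hit by little mass. -/
structure IsNode {d : ℕ} (ψ : ℕ → ℝ) (U : ℕ → Set (Fin d → ℝ)) (ρ : ℕ → ℝ) (s c : ℝ)
    (z : Fin d → ℝ) (r : ℝ) (P : ℕ) : Prop where
  pos : 0 < r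
  le_one : r ≤ 1
  one_le : 1 ≤ P
  clean : IsClean d ψ r P
  hitMass_lt : hitMass U ρ s (closedBall z r) < c * r ^ s

/-- The points of the smaller ball are `ψ`-close to a rational vector with denominator at least `P`
and `(1 - ε) ψ`-far from all rational vectors with denominators in `[P, P')`. -/
structure IsStep {d : ℕ} (ψ : ℕ → ℝ) (ε : ℝ) (z : Fin d → ℝ) (r : ℝ) (P : ℕ) (z' : Fin d → ℝ)
    (r' : ℝ) (P' : ℕ) : Prop where
  subset : closedBall z' r' ⊆ closedBall z r
  lt : P < P'
  radius_le : r' ≤ r / 2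
  near : ∃ (q : ℕ) (p : Fin d → ℤ), 1 ≤ q ∧ P ≤ q ∧
    ∀ x ∈ closedBall z' r', dist x (ratVec p q) < ψ q
  far : ∀ x ∈ closedBall z' r', ∀ n, P ≤ n → n < P' → ∀ p : Fin d → ℤ,
    (1 - ε) * ψ n ≤ dist x (ratVec p n)

/-- The bounds `ρm` and `M'` are left free because they have two sources: the smallness of the cover
for the initial cube, and the node condition afterwards. -/
lemma exists_isStep {d : ℕ} (hd : d ≠ 0) {ψ : ℕ → ℝ} (hψ : ∀ q, 1 ≤ q → 0 < ψ q)
    (hmono : AntitoneOn ψ (Set.Ici 1)) {s : ℝ} (hs : 0 < s) (hsd : s < d)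
    (hdiv : ¬ Summable fun q : ℕ => (q : ℝ) ^ d * ψ q ^ s)
    {B : ℝ} (hB : 1 / denRatio d ≤ B) (hψB : ∀ q : ℕ, B ≤ q → 2 * (q : ℝ) ^ 3 * ψ q ≤ 1)
    {U : ℕ → Set (Fin d → ℝ)} {ρ : ℕ → ℝ} (hU : IsSummableCover U ρ s)
    {z : Fin d → ℝ} {r : ℝ} {P : ℕ} (hr : 0 < r) (hr1 : r ≤ 1) (hP : 1 ≤ P)
    (hclean : IsClean d ψ r P) {ρm M' : ℝ}
    (hρm : ∀ i, (U i ∩ closedBall z r).Nonempty → ρ i ≤ ρm) (hρm0 : 0 ≤ ρm)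
    (hM' : hitMass U ρ s (closedBall z r) ≤ M')
    (hsmall : 2 ^ d * ρm ^ ((d : ℝ) - s) * M' ≤ density d * r ^ d / 2)
    {c : ℝ} (hc : 0 < c) {ε : ℝ} (hε : 0 < ε) (hε1 : ε < 1) :
    ∃ z' r' P', IsStep ψ ε z r P z' r' P' ∧ IsNode ψ U ρ s c z' r' P' := by
  obtain ⟨N, a, hN, ha, hmass⟩ := exists_child_hitMass_lt hd hψ hmono hs hsd hdiv hψB hU hr hr1 hP
    -- The first lower bound on the denominator makes the new ball clean; the second pushes it past
    -- the old threshold `P`.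
    hclean hρm hρm0 hM' hsmall hc hε hε1 (max (48 / (ε * badRatio d)) (P + 1))
  set B' := max B (max (48 / (ε * badRatio d)) (P + 1)) with hB'
  have hBB' : B ≤ B' := le_max_left _ _
  have hψB' : ∀ q : ℕ, B' ≤ q → 2 * (q : ℝ) ^ 3 * ψ q ≤ 1 := fun q hq => hψB q (hBB'.trans hq)
  have hden : B' ≤ vecDen a := hN.le_den.trans ha.le_den
  have hq1 := ha.one_le
  have hψa := hψ _ hq1
  have hPq : (P : ℝ) + 1 ≤ vecDen a :=
    ((le_max_right _ _).trans (le_max_right _ _)).trans hden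
  have hPq' : P + 1 ≤ vecDen a := by exact_mod_cast hPq
  have hεq : 48 / (ε * badRatio d) ≤ vecDen a :=
    ((le_max_left _ _).trans (le_max_right _ _)).trans hden
  have hlt : P < nextDen ψ (vecDen a) := by
    have h1 := sq_le_nextDen hq1 hψa (hψB' _ hden)
    have h2 : vecDen a ≤ vecDen a ^ 2 := Nat.le_self_pow two_ne_zero _
    omega
  have hrad : ε * ψ (vecDen a) / 4 ≤ r / 2 := by
    have h1 := ha.psi_le_spacing hd hψB' hN
    have h2 := hN.spacing_le_self
    have h3 : ε * ψ (vecDen a) ≤ 1 * ψ (vecDen a) := by gcongr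
    linarith
  refine ⟨shellCenter ψ ε a, ε * ψ (vecDen a) / 4, nextDen ψ (vecDen a), ?_, ?_⟩
  · obtain ⟨p, hp⟩ := ha.eq_ratVec
    refine ⟨ha.shellBall_subset hd hψ hψB' hε hε1 hN, hlt, hrad,
      ⟨vecDen a, p, hq1, by omega, fun x hx => ?_⟩, fun x hx n hPn hn p => ?_⟩
    · rw [← hp]
      exact (dist_of_mem_shellBall hd hε hε1 hψa hx).2
    · exact ha.le_dist_ratVec hd hψ hmono (hB.trans hBB') hψB' hε hε1 hP hN hx hPn hn p
  · exact ⟨by positivity, by linarith, by omega,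
      isClean_nextDen hd hψ hψB' hε hε1 hq1 hden hεq, hmass⟩

/-- The constant in the bound for the mass hitting an admissible ball. -/
noncomputable def massConst (d : ℕ) (s : ℝ) : ℝ := (density d / 2 ^ (d + 1)) ^ (s / d)

lemma massConst_pos (d : ℕ) (s : ℝ) : 0 < massConst d s := by
  have := density_pos d
  unfold massConst; positivity

/-- Sets meeting the ball satisfy `ρ i ≤ (c * r ^ s) ^ (1 / s)`, so the left side of the smallness
condition becomes `2 ^ d * c ^ (d / s) * r ^ d`. It scales like the right side, and `massConst` is
the value of `c` giving equality. -/
lemma IsNode.exists_isStep {d : ℕ} (hd : d ≠ 0) {ψ : ℕ → ℝ} (hψ : ∀ q, 1 ≤ q → 0 < ψ q)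
    (hmono : AntitoneOn ψ (Set.Ici 1)) {s : ℝ} (hs : 0 < s) (hsd : s < d)
    (hdiv : ¬ Summable fun q : ℕ => (q : ℝ) ^ d * ψ q ^ s)
    {B : ℝ} (hB : 1 / denRatio d ≤ B) (hψB : ∀ q : ℕ, B ≤ q → 2 * (q : ℝ) ^ 3 * ψ q ≤ 1)
    {U : ℕ → Set (Fin d → ℝ)} {ρ : ℕ → ℝ} (hU : IsSummableCover U ρ s)
    {z : Fin d → ℝ} {r : ℝ} {P : ℕ} (h : IsNode ψ U ρ s (massConst d s) z r P)
    {ε : ℝ} (hε : 0 < ε) (hε1 : ε < 1) :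
    ∃ z' r' P', IsStep ψ ε z r P z' r' P' ∧ IsNode ψ U ρ s (massConst d s) z' r' P' := by
  have hr := h.pos
  have hc := massConst_pos d s
  have hd0 : (0 : ℝ) < d := by positivity
  set c := massConst d s with hcdef
  have hcr : 0 < c * r ^ s := by positivity
  refine _root_.exists_isStep hd hψ hmono hs hsd hdiv hB hψB hU hr h.le_one h.one_le h.clean
    (ρm := (c * r ^ s) ^ s⁻¹) (M' := c * r ^ s) (fun i hi => ?_) (by positivity) h.hitMass_lt.le ?_
    hc hε hε1
  · rw [Real.le_rpow_inv_iff_of_pos (hU.pos i).le hcr.le hs]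
    exact (rpow_le_hitMass hU hi).trans h.hitMass_lt.le
  · have e1 : ((c * r ^ s) ^ s⁻¹) ^ ((d : ℝ) - s) * (c * r ^ s) = c ^ ((d : ℝ) / s) * r ^ d := by
      rw [← Real.rpow_mul hcr.le]
      nth_rewrite 2 [← Real.rpow_one (c * r ^ s)]
      rw [← Real.rpow_add hcr, Real.mul_rpow hc.le (by positivity), ← Real.rpow_mul hr.le,
        ← Real.rpow_natCast r d]
      have e2 : s⁻¹ * ((d : ℝ) - s) + 1 = d / s := by field_simp; ring
      rw [e2, mul_div_cancel₀ _ hs.ne']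
    have e3 : c ^ ((d : ℝ) / s) = density d / 2 ^ (d + 1) := by
      have := density_pos d
      rw [hcdef, massConst, ← Real.rpow_mul (by positivity), div_mul_div_comm, mul_comm s,
        div_self (by positivity), Real.rpow_one]
    rw [mul_assoc, e1, e3, pow_succ]
    apply le_of_eq
    field_simp

lemma finite_pairs {d : ℕ} (ψ : ℕ → ℝ) (x : Fin d → ℝ) (n : ℕ) :
    {pq : (Fin d → ℤ) × ℕ | 1 ≤ pq.2 ∧ pq.2 < n ∧ dist (ratVec pq.1 pq.2) x ≤ ψ pq.2}.Finite := by
  refine ((Set.finite_Ico 1 n).biUnion (t := fun q =>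
    (fun p => (p, q)) '' {p : Fin d → ℤ | dist (ratVec p q) x ≤ ψ q}) fun q hq =>
      (finite_ratVec x (ψ q) hq.1).image _).subset ?_
  rintro ⟨p, q⟩ ⟨h1, h2, h3⟩
  exact Set.mem_biUnion (Set.mem_Ico.mpr ⟨h1, h2⟩) ⟨p, h3, rfl⟩

lemma exists_large_denominator {d : ℕ} {ψ : ℕ → ℝ} {x : Fin d → ℝ} (hx : x ∈ wellApprox d ψ)
    (n : ℕ) : ∃ (p : Fin d → ℤ) (q : ℕ), n ≤ q ∧ 1 ≤ q ∧ dist x (ratVec p q) < ψ q := by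
  by_contra! hcon
  refine hx.2 ((finite_pairs ψ x n).subset ?_)
  rintro ⟨p, q⟩ ⟨h1, h2⟩
  change ‖x - ratVec p q‖ < ψ q at h2
  rw [← dist_eq_norm] at h2
  refine ⟨h1, ?_, by rw [dist_comm]; exact h2.le⟩
  by_contra hn
  exact (hcon p q (not_lt.mp hn) h1).not_gt h2

/-- A point in the intersection of a sequence of steps with `ε → 0` is exactly approximable. -/
lemma mem_exactApprox_of_steps {d : ℕ} {ψ : ℕ → ℝ} (hψ : ∀ q, 1 ≤ q → 0 < ψ q) {ε : ℕ → ℝ}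
    (hε : Filter.Tendsto ε Filter.atTop (nhds 0)) {z : ℕ → Fin d → ℝ} {r : ℕ → ℝ} {P : ℕ → ℕ}
    (hstep : ∀ k, IsStep ψ (ε k) (z k) (r k) (P k) (z (k + 1)) (r (k + 1)) (P (k + 1)))
    {x : Fin d → ℝ} (hx : ∀ k, x ∈ closedBall (z k) (r k)) (hx01 : x ∈ Set.Icc (0 : Fin d → ℝ) 1) :
    x ∈ exactApprox d ψ := by
  have hPmono : StrictMono P := strictMono_nat_of_lt_succ fun k => (hstep k).lt
  constructor
  · refine ⟨hx01, Set.Infinite.of_image Prod.snd (Set.infinite_of_forall_exists_gt fun n => ?_)⟩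
    obtain ⟨q, p, hq1, hPq, hnear⟩ := (hstep (n + 1)).near
    refine ⟨q, ⟨(p, q), ⟨hq1, ?_⟩, rfl⟩, ?_⟩
    · have := hnear x (hx _)
      rwa [dist_eq_norm] at this
    · have := hPmono.le_apply (x := n + 1)
      omega
  · simp only [Set.mem_iUnion, not_exists]
    rintro δ ⟨hδ0, hδ1⟩ hxδ
    obtain ⟨k₀, hk₀⟩ := Filter.eventually_atTop.mp (hε.eventually (gt_mem_nhds hδ0))
    obtain ⟨p, q, hq, hq1, hlt⟩ := exists_large_denominator hxδ (P k₀)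
    have hex : ∃ k, k₀ ≤ k ∧ q < P (k + 1) :=
      ⟨max k₀ q, le_max_left _ _, by
        have := hPmono.le_apply (x := max k₀ q + 1)
        have := le_max_right k₀ q
        omega⟩
    classical
    -- The least such `k` locates `q` in `[P k, P (k + 1))` with `ε k < δ`.
    obtain ⟨k, ⟨hk, hqk⟩, hmin⟩ : ∃ k, (k₀ ≤ k ∧ q < P (k + 1)) ∧
        ∀ j < k, ¬ (k₀ ≤ j ∧ q < P (j + 1)) :=
      ⟨Nat.find hex, Nat.find_spec hex, fun j hj => Nat.find_min hex hj⟩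
    have hPk : P k ≤ q := by
      rcases eq_or_lt_of_le hk with rfl | hk
      · exact hq
      · by_contra hn
        refine hmin (k - 1) (by omega) ⟨by omega, ?_⟩
        rw [Nat.sub_add_cancel (by omega)]
        omega
    have h1 := (hstep k).far x (hx _) q hPk hqk p
    have h2 := hk₀ k hk
    have h3 := hψ q hq1
    nlinarith

/-- For `r = 1 / 2` the terms are at most `4 / n ^ 2`, so any large threshold works; this starts the
construction in the unit cube. -/
lemma exists_isClean_half {d : ℕ} (hd : d ≠ 0) {ψ : ℕ → ℝ} (hψ : ∀ q, 1 ≤ q → 0 < ψ q)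
    {B : ℝ} (hψB : ∀ q : ℕ, B ≤ q → 2 * (q : ℝ) ^ 3 * ψ q ≤ 1) :
    ∃ P, 1 ≤ P ∧ IsClean d ψ (1 / 2) P := by
  have hκ := badRatio_pos d
  obtain ⟨P, hP⟩ := exists_nat_ge (|B| + 2 + 8 / (badRatio d * (1 / 2) ^ d))
  have h8 : 0 < 8 / (badRatio d * (1 / 2) ^ d) := by positivity
  have hP2 : (2 : ℝ) ≤ P := by linarith [abs_nonneg B]
  have hP1 : 1 ≤ P := by
    have : (1 : ℝ) ≤ P := by linarith
    exact_mod_cast this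
  refine ⟨P, hP1, fun m => ?_⟩
  have hterm : ∀ n ∈ Finset.Ico P m, (2 * (1 / 2) * (n : ℝ) + 1) ^ d * (4 * ψ n) ^ d ≤
      4 * (1 / (n : ℝ) ^ 2) := by
    intro n hn
    have hPn : (P : ℝ) ≤ n := by exact_mod_cast (Finset.mem_Ico.mp hn).1
    have hn1 : 1 ≤ n := hP1.trans (Finset.mem_Ico.mp hn).1
    have hn0 : (0 : ℝ) < n := by exact_mod_cast hn1
    have hψn := hψ n hn1
    have h3 : 4 * ψ n ≤ 2 / (n : ℝ) ^ 3 := by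
      rw [le_div_iff₀ (by positivity)]
      linarith [hψB n (by linarith [le_abs_self B])]
    have h4 : (2 * (1 / 2) * (n : ℝ) + 1) * (4 * ψ n) ≤ 4 * (1 / (n : ℝ) ^ 2) := by
      calc _ ≤ 2 * (n : ℝ) * (2 / (n : ℝ) ^ 3) := by gcongr; linarith
        _ = _ := by field_simp; ring
    have h5 : 4 * (1 / (n : ℝ) ^ 2) ≤ 1 := by
      rw [mul_one_div, div_le_one (by positivity)]
      nlinarith
    rw [← mul_pow]
    exact (pow_le_pow_left₀ (by positivity) h4 d).trans (pow_le_of_le_one (by positivity) h5 hd)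
  refine (Finset.sum_le_sum hterm).trans ?_
  rw [← Finset.mul_sum]
  calc 4 * ∑ n ∈ Finset.Ico P m, 1 / (n : ℝ) ^ 2 ≤ 4 * (2 / (P : ℝ)) := by
        gcongr; exact sum_Ico_inv_sq_le hP1 m
    _ = 8 / (P : ℝ) := by ring
    _ ≤ _ := by
      have : 8 / (badRatio d * (1 / 2) ^ d) ≤ P := by linarith [abs_nonneg B]
      rw [div_le_iff₀ (by positivity)] at this
      rw [div_le_iff₀ (by positivity)]
      linarith

/-- Sets of small total size do not cover the exactly approximable points. -/
lemma exists_mem_exactApprox_notMem {d : ℕ} (hd : d ≠ 0) {ψ : ℕ → ℝ} (hψ : ∀ q, 1 ≤ q → 0 < ψ q)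
    (hmono : AntitoneOn ψ (Set.Ici 1)) {s : ℝ} (hs : 0 < s) (hsd : s < d)
    (hdiv : ¬ Summable fun q : ℕ => (q : ℝ) ^ d * ψ q ^ s)
    {B : ℝ} (hB : 1 / denRatio d ≤ B) (hψB : ∀ q : ℕ, B ≤ q → 2 * (q : ℝ) ^ 3 * ψ q ≤ 1)
    {U : ℕ → Set (Fin d → ℝ)} {ρ : ℕ → ℝ} (hU : IsSummableCover U ρ s) {ρm M' : ℝ}
    (hρm : ∀ i, ρ i ≤ ρm) (hM' : ∑' i, ρ i ^ s ≤ M')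
    (hsmall : 2 ^ d * ρm ^ ((d : ℝ) - s) * M' ≤ density d * (1 / 2) ^ d / 2) :
    ∃ x ∈ exactApprox d ψ, ∀ i, x ∉ U i := by
  classical
  obtain ⟨P₀, hP₀, hclean⟩ := exists_isClean_half hd hψ hψB
  have hmass0 : hitMass U ρ s (closedBall (fun _ => 1 / 2) (1 / 2)) ≤ M' := by
    refine le_trans ?_ hM'
    have hρs : ∀ i, 0 ≤ ρ i ^ s := fun i => Real.rpow_nonneg (hU.pos i).le s
    refine Summable.tsum_le_tsum (fun i => ?_) (Summable.of_nonneg_of_le (fun i => ?_)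
      (fun i => ?_) hU.summable) hU.summable <;> split_ifs <;> simp [hρs i]
  obtain ⟨z₀, r₀, Q₀, hstep₀, hnode₀⟩ := exists_isStep hd hψ hmono hs hsd hdiv hB hψB hU
    (z := fun _ => 1 / 2) (r := 1 / 2) (by norm_num) (by norm_num) hP₀ hclean (fun i _ => hρm i)
    ((hU.pos 0).le.trans (hρm 0)) hmass0 hsmall (massConst_pos d s) (ε := 1 / 2) (by norm_num)
    (by norm_num)
  let Nd := {n : (Fin d → ℝ) × ℝ × ℕ // IsNode ψ U ρ s (massConst d s) n.1 n.2.1 n.2.2}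
  have hnext : ∀ (k : ℕ) (n : Nd), ∃ n' : Nd,
      IsStep ψ (1 / ((k : ℝ) + 2)) n.1.1 n.1.2.1 n.1.2.2 n'.1.1 n'.1.2.1 n'.1.2.2 := by
    intro k n
    have hk : (0 : ℝ) ≤ k := Nat.cast_nonneg k
    obtain ⟨z', r', P', h1, h2⟩ := n.2.exists_isStep hd hψ hmono hs hsd hdiv hB hψB hU
      (ε := 1 / ((k : ℝ) + 2)) (by positivity) (by
        rw [div_lt_one (by positivity)]; linarith)
    exact ⟨⟨(z', r', P'), h2⟩, h1⟩
  choose next hnext using hnext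
  let f : ℕ → Nd := fun k => Nat.rec ⟨(z₀, r₀, Q₀), hnode₀⟩ (fun k n => next k n) k
  have hstep : ∀ k : ℕ, IsStep ψ (1 / ((k : ℝ) + 2)) (f k).1.1 (f k).1.2.1 (f k).1.2.2
      (f (k + 1)).1.1 (f (k + 1)).1.2.1 (f (k + 1)).1.2.2 := fun k => hnext k (f k)
  obtain ⟨x, hx⟩ := IsCompact.nonempty_iInter_of_sequence_nonempty_isCompact_isClosed
    (fun k => closedBall (f k).1.1 (f k).1.2.1) (fun k => (hstep k).subset)
    (fun k => nonempty_closedBall.mpr (f k).2.pos.le) (isCompact_closedBall _ _)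
    (fun k => isClosed_closedBall)
  rw [Set.mem_iInter] at hx
  refine ⟨x, mem_exactApprox_of_steps hψ ?_ hstep hx ?_, fun i hi => ?_⟩
  · exact (tendsto_const_nhds (x := (1 : ℝ))).div_atTop
      (Filter.tendsto_atTop_add_const_right _ _ tendsto_natCast_atTop_atTop)
  · have h0 : x ∈ closedBall (fun _ => 1 / 2) (1 / 2) := hstep₀.subset (hx 0)
    rw [mem_closedBall, dist_pi_le_iff (by norm_num)] at h0
    refine ⟨fun j => ?_, fun j => ?_⟩ <;>
    · have := abs_le.mp ((Real.dist_eq _ _).symm.trans_le (h0 j))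
      simp only [Pi.zero_apply, Pi.one_apply]
      linarith [this.1, this.2]
  · have hrad : ∀ k, (f k).1.2.1 ≤ r₀ * (1 / 2) ^ k := by
      intro k
      induction k with
      | zero => simp [f]
      | succ k ih =>
        refine (hstep k).radius_le.trans ?_
        rw [pow_succ]
        linarith
    have hr0 : Filter.Tendsto (fun k => (f k).1.2.1) Filter.atTop (nhds 0) := by
      refine squeeze_zero (fun k => (f k).2.pos.le) hrad ?_
      simpa using (tendsto_pow_atTop_nhds_zero_of_lt_one (r := (1 / 2 : ℝ)) (by norm_num)
        (by norm_num)).const_mul r₀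
    have hlim : Filter.Tendsto (fun k => massConst d s * (f k).1.2.1 ^ s) Filter.atTop
        (nhds 0) := by
      have := (hr0.rpow_const (p := s) (Or.inr hs.le)).const_mul (massConst d s)
      rwa [Real.zero_rpow hs.ne', mul_zero] at this
    have hle : ρ i ^ s ≤ 0 := ge_of_tendsto hlim (Filter.Eventually.of_forall fun k =>
      (rpow_le_hitMass hU ⟨x, hi, hx k⟩).trans (f k).2.hitMass_lt.le)
    exact hle.not_gt (Real.rpow_pos_of_pos (hU.pos i) s)

/-- The terms `(q ^ 3 * ψ q) ^ d` of a convergent series are eventually below `(1 / 2) ^ d`. -/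
lemma exists_two_mul_cube_mul_le {d : ℕ} {ψ : ℕ → ℝ}
    (hsum : Summable (fun q : ℕ => (q : ℝ) ^ (3 * d) * ψ q ^ d)) :
    ∃ B : ℝ, 1 / denRatio d ≤ B ∧ ∀ q : ℕ, B ≤ q → 2 * (q : ℝ) ^ 3 * ψ q ≤ 1 := by
  obtain ⟨N, hN⟩ := Filter.eventually_atTop.mp
    (hsum.tendsto_atTop_zero.eventually (gt_mem_nhds (show (0 : ℝ) < (1 / 2) ^ d by positivity)))
  refine ⟨max N (1 / denRatio d), le_max_right _ _, fun q hq => ?_⟩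
  have h1 := hN q (by exact_mod_cast (le_max_left _ _).trans hq)
  rw [pow_mul, ← mul_pow] at h1
  have := lt_of_pow_lt_pow_left₀ d (by norm_num) h1
  linarith

/-! ### The convergence case -/

lemma hausdorffMeasure_wellApprox_eq_zero {d : ℕ} {ψ : ℕ → ℝ}
    (hψ : ∀ q, 1 ≤ q → 0 < ψ q) (hmono : AntitoneOn ψ (Set.Ici 1))
    (hψ0 : Filter.Tendsto ψ Filter.atTop (nhds 0)) {s : ℝ} (hs : 0 < s)
    (hconv : Summable fun q : ℕ => (q : ℝ) ^ d * ψ q ^ s) :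
    Measure.hausdorffMeasure s (wellApprox d ψ) = 0 := by
  -- Every rational vector within `ψ q ≤ ψ 1` of the unit cube has norm at most `R`.
  set R := 1 + ψ 1 with hR
  have hR0 : 0 < R := by have := hψ 1 le_rfl; positivity
  set C := (2 * R + 1) ^ d * 2 ^ s with hC
  have hC0 : 0 < C := by positivity
  let F : ℕ → ENNReal := fun q => ENNReal.ofReal (C * ((q : ℝ) ^ d * ψ q ^ s))
  have hF : ∑' q, F q ≠ ⊤ := (hconv.mul_left C).tsum_ofReal_ne_top
  have hFlim := ENNReal.tendsto_sum_nat_add F hF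
  have hlim := Measure.hausdorffMeasure_le_liminf_tsum (β := ℕ)
    (ι := fun n => (q : ℕ) × (ratPts (0 : Fin d → ℝ) R (q + n) : Finset (Fin d → ℝ))) s
    (wellApprox d ψ) (l := Filter.atTop) (fun n => ENNReal.ofReal (2 * ψ n)) (by
      have := ENNReal.tendsto_ofReal (hψ0.const_mul 2)
      simpa using this)
    (fun n i => ball (i.2 : Fin d → ℝ) (ψ (i.1 + n)))
    (by
      filter_upwards [Filter.eventually_ge_atTop 1] with n hn i
      refine ediam_le_of_forall_dist_le fun x hx y hy => ?_
      rw [mem_ball] at hx hy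
      have := hmono (a := n) hn (b := i.1 + n) (by simp; omega) (by omega)
      linarith [dist_triangle_right x y (i.2 : Fin d → ℝ)])
    (by
      filter_upwards [Filter.eventually_ge_atTop 1] with n hn x hx
      obtain ⟨p, q, hnq, hq1, hlt⟩ := exists_large_denominator hx n
      obtain ⟨m, rfl⟩ := Nat.exists_eq_add_of_le' hnq
      rw [Set.mem_iUnion]
      refine ⟨⟨m, ⟨ratVec p (m + n), mem_ratPts.mpr ⟨hq1, ?_, p, rfl⟩⟩⟩, hlt⟩
      have hx0 : dist x 0 ≤ 1 := by
        rw [dist_pi_le_iff zero_le_one]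
        intro j
        have h1 := hx.1.1 j
        have h2 := hx.1.2 j
        simp only [Pi.zero_apply, Pi.one_apply] at h1 h2
        rw [Pi.zero_apply, Real.dist_eq, sub_zero, abs_of_nonneg h1]
        exact h2
      have h3 : ψ (m + n) ≤ ψ 1 := hmono (mem_Ici.mpr le_rfl) (mem_Ici.mpr hq1) hq1
      linarith [dist_triangle_left (ratVec p (m + n)) 0 x])
  refine le_antisymm (hlim.trans ?_) bot_le
  refine le_trans (Filter.liminf_le_liminf (v := fun n => ∑' q, F (q + n)) ?_) hFlim.liminf_eq.le
  filter_upwards [Filter.eventually_ge_atTop 1] with n hn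
  rw [ENNReal.tsum_sigma']
  refine ENNReal.tsum_le_tsum fun q => ?_
  have hqn : 1 ≤ q + n := by omega
  have hqn' : (1 : ℝ) ≤ ((q + n : ℕ) : ℝ) := by exact_mod_cast hqn
  have hψq := hψ _ hqn
  have hball : ∀ a : (ratPts (0 : Fin d → ℝ) R (q + n) : Finset (Fin d → ℝ)),
      ediam (ball (a : Fin d → ℝ) (ψ (q + n))) ^ s ≤ ENNReal.ofReal ((2 * ψ (q + n)) ^ s) := by
    intro a
    rw [← ENNReal.ofReal_rpow_of_pos (by positivity)]
    refine ENNReal.rpow_le_rpow (ediam_le_of_forall_dist_le fun x hx y hy => ?_) hs.le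
    rw [mem_ball] at hx hy
    linarith [dist_triangle_right x y (a : Fin d → ℝ)]
  refine (ENNReal.tsum_le_tsum hball).trans ?_
  rw [tsum_fintype, Finset.sum_const, Finset.card_univ, Fintype.card_coe, nsmul_eq_mul,
    ← ENNReal.ofReal_natCast, ← ENNReal.ofReal_mul (by positivity)]
  refine ENNReal.ofReal_le_ofReal ?_
  have hcard : ((ratPts (0 : Fin d → ℝ) R (q + n)).card : ℝ) ≤
      (2 * R + 1) ^ d * ((q + n : ℕ) : ℝ) ^ d := by
    refine (card_ratPts_le 0 hR0.le (q + n)).trans ?_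
    rw [← mul_pow]
    gcongr
    linarith
  calc _ ≤ (2 * R + 1) ^ d * ((q + n : ℕ) : ℝ) ^ d * (2 * ψ (q + n)) ^ s := by gcongr
    _ = _ := by
      rw [Real.mul_rpow two_pos.le hψq.le, hC]; ring

/-! ### The divergence case and the theorem -/

/-- A set of finite Hausdorff measure has covers by small sets with controlled total size. -/
lemma exists_isSummableCover {X : Type*} [MetricSpace X] [MeasurableSpace X] [BorelSpace X]
    {s : ℝ} (hs : 0 < s) {E : Set X} (hE : Measure.hausdorffMeasure s E ≠ ⊤) {ρm : ℝ}
    (hρm : 0 < ρm) :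
    ∃ (U : ℕ → Set X) (ρ : ℕ → ℝ), IsSummableCover U ρ s ∧ E ⊆ ⋃ i, U i ∧ (∀ i, ρ i ≤ ρm) ∧
      ∑' i, ρ i ^ s ≤ (Measure.hausdorffMeasure s E).toReal + 3 := by
  set M := Measure.hausdorffMeasure s E with hM
  have hlt : (⨅ (t : ℕ → Set X) (_ : E ⊆ ⋃ n, t n) (_ : ∀ n, ediam (t n) ≤ ENNReal.ofReal ρm),
      ∑' n, ⨆ _ : (t n).Nonempty, ediam (t n) ^ s) < M + 1 := by
    refine lt_of_le_of_lt ?_ (ENNReal.lt_add_right hE one_ne_zero)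
    rw [hM, Measure.hausdorffMeasure_apply]
    exact le_iSup₂_of_le (ENNReal.ofReal ρm) (ENNReal.ofReal_pos.mpr hρm) le_rfl
  simp only [iInf_lt_iff] at hlt
  obtain ⟨t, hcov, hdiam, htlt⟩ := hlt
  set f : ℕ → ENNReal := fun n => ⨆ _ : (t n).Nonempty, ediam (t n) ^ s with hf
  have hftop : ∑' n, f n ≠ ⊤ := ne_top_of_lt htlt
  have hfs := ENNReal.summable_toReal hftop
  have hfsum : ∑' n, (f n).toReal ≤ M.toReal + 1 := by
    rw [← ENNReal.tsum_toReal_eq fun n => ENNReal.ne_top_of_tsum_ne_top hftop n,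
      ← ENNReal.toReal_one, ← ENNReal.toReal_add hE ENNReal.one_ne_top]
    exact ENNReal.toReal_mono (ENNReal.add_ne_top.mpr ⟨hE, ENNReal.one_ne_top⟩) htlt.le
  -- Sets of diameter `0` also need positive bounds `ρ i`. The `η i ^ s` add at most `2` to the sum,
  -- and the near-optimal cover adds `1`, hence the `3` in the statement.
  set η : ℕ → ℝ := fun i => min ρm (((1 / 2 : ℝ) ^ i) ^ s⁻¹) with hη
  have hη0 : ∀ i, 0 < η i := fun i => lt_min hρm (by positivity)
  have hηs : ∀ i, η i ^ s ≤ (1 / 2) ^ i := fun i => by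
    calc η i ^ s ≤ (((1 / 2 : ℝ) ^ i) ^ s⁻¹) ^ s :=
          Real.rpow_le_rpow (hη0 i).le (min_le_right _ _) hs.le
      _ = _ := Real.rpow_inv_rpow (by positivity) hs.ne'
  have hdtop : ∀ i, ediam (t i) ≠ ⊤ := fun i => ne_top_of_le_ne_top ENNReal.ofReal_ne_top (hdiam i)
  have hdf : ∀ i, diam (t i) ^ s ≤ (f i).toReal := by
    intro i
    rcases (t i).eq_empty_or_nonempty with h | h
    · rw [h, diam_empty, Real.zero_rpow hs.ne']
      exact ENNReal.toReal_nonneg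
    · have : f i = ediam (t i) ^ s := by simp [hf, h]
      rw [this, ← ENNReal.toReal_rpow]
      rfl
  set ρ : ℕ → ℝ := fun i => max (diam (t i)) (η i) with hρ
  have hρ0 : ∀ i, 0 < ρ i := fun i => (hη0 i).trans_le (le_max_right _ _)
  have hρs : ∀ i, ρ i ^ s ≤ (f i).toReal + (1 / 2) ^ i := by
    intro i
    have h1 := hdf i
    have h2 := hηs i
    have h3 := Real.rpow_nonneg (diam_nonneg (s := t i)) s
    have h4 := Real.rpow_nonneg (hη0 i).le s
    rcases max_choice (diam (t i)) (η i) with h | h <;> simp only [hρ, h] <;> linarith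
  have hgs : Summable fun i => (f i).toReal + (1 / 2 : ℝ) ^ i := hfs.add summable_geometric_two
  have hsum : Summable fun i => ρ i ^ s :=
    Summable.of_nonneg_of_le (fun i => Real.rpow_nonneg (hρ0 i).le s) hρs hgs
  refine ⟨t, ρ, ⟨hρ0, fun i x hx y hy => ?_, hsum⟩, hcov, fun i => max_le ?_ (min_le_left _ _), ?_⟩
  · exact (dist_le_diam_of_mem' (hdtop i) hx hy).trans (le_max_left _ _)
  · exact ENNReal.toReal_le_of_le_ofReal hρm.le (hdiam i)
  · refine (hsum.tsum_le_tsum hρs hgs).trans ?_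
    rw [hfs.tsum_add summable_geometric_two, tsum_geometric_two]
    linarith

lemma hausdorffMeasure_exactApprox_eq_top {d : ℕ} (hd : d ≠ 0) {ψ : ℕ → ℝ}
    (hψ : ∀ q, 1 ≤ q → 0 < ψ q) (hmono : AntitoneOn ψ (Set.Ici 1)) {B : ℝ}
    (hB : 1 / denRatio d ≤ B) (hψB : ∀ q : ℕ, B ≤ q → 2 * (q : ℝ) ^ 3 * ψ q ≤ 1)
    {s : ℝ} (hs : 0 < s) (hsd : s < d)
    (hdiv : ¬ Summable fun q : ℕ => (q : ℝ) ^ d * ψ q ^ s) :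
    Measure.hausdorffMeasure s (exactApprox d ψ) = ⊤ := by
  by_contra hE
  have hdens := density_pos d
  set M' := (Measure.hausdorffMeasure s (exactApprox d ψ)).toReal + 3 with hM'
  have hM0 : 0 < M' := by positivity
  -- Chosen so that `ρm ^ (d - s) = κ` gives equality in the smallness condition for the initial
  -- cube.
  set κ := density d * (1 / 2) ^ d / 2 / (2 ^ d * M') with hκ
  have hκ0 : 0 < κ := by positivity
  have hds : (d : ℝ) - s ≠ 0 := by linarith
  obtain ⟨U, ρ, hU, hcov, hρ, hsum⟩ := exists_isSummableCover hs hE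
    (ρm := κ ^ ((d : ℝ) - s)⁻¹) (by positivity)
  obtain ⟨x, hx, hxU⟩ := exists_mem_exactApprox_notMem hd hψ hmono hs hsd hdiv hB hψB hU hρ hsum (by
    rw [Real.rpow_inv_rpow hκ0.le hds, hκ, ← hM']
    apply le_of_eq
    field_simp)
  obtain ⟨i, hi⟩ := Set.mem_iUnion.mp (hcov hx)
  exact hxU i hi

theorem theorem3p2 (d : ℕ) (ψ : ℕ → ℝ)
    (hpos : ∀ q : ℕ, 1 ≤ q → 0 < ψ q)
    (hmono : AntitoneOn ψ (Set.Ici 1))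
    (hsum : Summable (fun q : ℕ => (q : ℝ) ^ (3 * d) * ψ q ^ d))
    (s : ℝ) (hs0 : 0 < s) (hsd : s < (d : ℝ)) :
    (Summable (fun q : ℕ => (q : ℝ) ^ d * ψ q ^ s) →
        MeasureTheory.Measure.hausdorffMeasure s (exactApprox d ψ) = 0) ∧
    (¬ Summable (fun q : ℕ => (q : ℝ) ^ d * ψ q ^ s) →
        MeasureTheory.Measure.hausdorffMeasure s (exactApprox d ψ) = ⊤) := by
  have hd : d ≠ 0 := by
    rintro rfl
    rw [Nat.cast_zero] at hsd
    linarith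
  obtain ⟨B, hB, hψB⟩ := exists_two_mul_cube_mul_le hsum
  have hψ0 : Filter.Tendsto ψ Filter.atTop (nhds 0) := by
    refine squeeze_zero' (g := fun q : ℕ => 1 / (q : ℝ)) ?_ ?_
      tendsto_one_div_atTop_nhds_zero_nat
    · filter_upwards [Filter.eventually_ge_atTop 1] with q hq using (hpos q hq).le
    · filter_upwards [Filter.eventually_ge_atTop 1, Filter.eventually_ge_atTop ⌈B⌉₊] with q hq hqB
      have h1 := hψB q (Nat.ceil_le.mp hqB)
      have h2 := hpos q hq
      have hq1 : (1 : ℝ) ≤ q := by exact_mod_cast hq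
      rw [le_div_iff₀ (by linarith)]
      have h3 : ψ q * q ≤ ψ q * (q : ℝ) ^ 3 := by
        gcongr
        exact le_self_pow₀ hq1 (by norm_num)
      have h4 : 0 < ψ q * (q : ℝ) ^ 3 := by positivity
      linarith
  refine ⟨fun hconv => ?_, fun hdiv =>
    hausdorffMeasure_exactApprox_eq_top hd hpos hmono hB hψB hs0 hsd hdiv⟩
  exact measure_mono_null Set.sdiff_subset
    (hausdorffMeasure_wellApprox_eq_zero hpos hmono hψ0 hs0 hconv)
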